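/- Let $d,m,r,\ell\ge 1$ be integers, $\mu=\frac{m-1}{2}$, $1\le p\le\infty$ and $\alpha\in[0,1)$. Let $W_\mu(x)=(1-\|x\|^2)^{\mu-1/2}$ on the closed unit ball $\mathbb B^d\subset\mathbb R^d$ and let $\|f\|_{p,\mu}$ be the norm of $L^p(\mathbb B^d,W_\mu)$, where for $p=\infty$ every $L^\infty$ space, here and below, is replaced by the space of continuous functions with the uniform norm. For $f:\mathbb B^d\to\mathbb R$ put $\widetilde f(x,x_{d+1})=f(x)$, considered as an element of $L^p(\mathbb B^{d+1},W_{\mu-1/2})$ if $m\ge2$, and of $L^p(\mathbb S^d)$ with surface measure if $m=1$; denote the norm of that space by $\|\cdot\|_{*}$. For $i\ne j$ let $Q_{i,j,\theta}$ be the rotation by the angle $\theta$ in the $(x_i,x_j)$-plane, let $\triangle_{i,j,\theta}^{k}f(x)=\sum_{\nu=0}^{k}(-1)^\nu\binom{k}{\nu}f(Q_{i,j,\nu\theta}x)$, and let $D_{i,j}=x_j\partial_i-x_i\partial_j$. The powers $D_{i,j}^r$ are taken in the distributional sense: $h=D_{i,j}^rf$ if $\int hg=(-1)^r\int f\,D_{i,j}^rg$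 for all $C^\infty$ functions $g$, where the integrals are over the relevant ball with its weight, or over the sphere with surface measure. Let $\mathcal W_p^{r,\alpha}(\mathbb B^d,W_\mu)$ be the space of all $f\in L^p(\mathbb B^d,W_\mu)$ whose derivatives $D_{i,j}^rf$ ($1\le i<j\le d$) and $D_{i,d+1}^r\widetilde f$ ($1\le i\le d$) lie in the corresponding $L^p$ spaces and for which $$\|f\|_{\mathcal W_p^{r,\alpha}}:=\|f\|_{p,\mu}+\max_{1\le i<j\le d}\ \sup_{0<|\theta|\le1}\frac{\|\triangle_{i,j,\theta}^{\ell}(D_{i,j}^rf)\|_{p,\mu}}{|\theta|^{\alpha}}+\max_{1\le i\le d}\ \sup_{0<|\theta|\le1}\frac{\|\triangle_{i,d+1,\theta}^{\ell}(D_{i,d+1}^r\widetilde f)\|_{*}}{|\theta|^{\alpha}}<\infty$$ (a maximum over the empty set is $0$). With the modulus of smoothness $$\omega_k(f,t)_{p,\mu}:=\sup_{|\theta|\le t}\max\Big\{\max_{1\le i<j\le d}\|\triangle_{i,j,\theta}^kf\|_{p,\mu},\ \max_{1\le i\le d}\|\triangle_{i,d+1,\theta}^k\widetilde f\|_{*}\Big\}$$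 let $H_p^{r+\alpha}(\mathbb B^d,W_\mu)$ be the space of all $f\in L^p(\mathbb B^d,W_\mu)$ with $$\|f\|_{H_p^{r+\alpha}}:=\|f\|_{p,\mu}+\sup_{0<t\le1}\frac{\omega_{r+\ell}(f,t)_{p,\mu}}{t^{r+\alpha}}<\infty .$$ If $0<\alpha<1$, then $\mathcal W_p^{r,\alpha}(\mathbb B^d,W_\mu)=H_p^{r+\alpha}(\mathbb B^d,W_\mu)$, and there is a constant $c>0$, depending only on $d,m,r,\ell,p,\alpha$, such that $c^{-1}\|f\|_{H_p^{r+\alpha}}\le\|f\|_{\mathcal W_p^{r,\alpha}}\le c\,\|f\|_{H_p^{r+\alpha}}$ for all $f$ in this space. If $\alpha=0$, then $\mathcal W_p^{r,0}(\mathbb B^d,W_\mu)\subseteq H_p^{r}(\mathbb B^d,W_\mu)$ and $\|f\|_{H_p^{r}}\le c\,\|f\|_{\mathcal W_p^{r,0}}$ for all $f\in\mathcal W_p^{r,0}(\mathbb B^d,W_\mu)$, with $c$ depending only on $d,m,r,\ell,p$. -/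

import Mathlib

open MeasureTheory Set
open scoped ENNReal ContDiff

noncomputable section

namespace BallLip

/-- Euclidean space `ℝⁿ`. -/
abbrev E (n : ℕ) : Type := EuclideanSpace ℝ (Fin n)

/-- The rotation `Q_{i,j,t}` by the angle `t` in the `(x_i, x_j)`-plane, oriented from `e_i` to
`e_j` (used for `i ≠ j`). -/
def planeRotation {n : ℕ} (i j : Fin n) (t : ℝ) (x : E n) : E n :=
  WithLp.toLp 2 fun k =>
    if k = i then x i * Real.cos t - x j * Real.sin t
    else if k = j then x i * Real.sin t + x j * Real.cos t
    else x k

/-- The difference `Δ_{i,j,θ}^r f (x) = ∑_{k=0}^r (-1)^k (r choose k) f (Q_{i,j,kθ} x)`. -/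
def angDiff {n : ℕ} (r : ℕ) (i j : Fin n) (θ : ℝ) (f : E n → ℝ) (x : E n) : ℝ :=
  ∑ k ∈ Finset.range (r + 1),
    (-1 : ℝ) ^ k * (r.choose k : ℝ) * f (planeRotation i j ((k : ℝ) * θ) x)

/-- The operator `D_{i,j} = x_j ∂_i - x_i ∂_j` on differentiable functions. -/
def angDeriv {n : ℕ} (i j : Fin n) (g : E n → ℝ) (x : E n) : ℝ :=
  x j * fderiv ℝ g x (EuclideanSpace.single i 1) - x i * fderiv ℝ g x (EuclideanSpace.single j 1)

/-- The measure `W_μ(x) dx` on the unit ball `𝔹ⁿ`, where `W_μ(x) = (1 - ‖x‖²)^(μ - 1/2)`. -/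
def ballMeasure (n : ℕ) (μ : ℝ) : Measure (E n) :=
  (volume.restrict (Metric.closedBall 0 1)).withDensity
    fun x => ENNReal.ofReal ((1 - ‖x‖ ^ 2) ^ (μ - 1 / 2))

/-- The surface measure `dσ` of the unit sphere of `ℝⁿ`, as a measure on `ℝⁿ`. -/
def sphereMeasure (n : ℕ) : Measure (E n) :=
  (volume : Measure (E n)).toSphere.map Subtype.val

/-- The set on which the extension `f̃` is considered: the unit ball `𝔹^{d+1}`, and the unit
sphere `𝕊^d` of `ℝ^{d+1}` when `μ = 0`. -/
def liftDomain (d : ℕ) (μ : ℝ) : Set (E (d + 1)) :=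
  open Classical in if μ = 0 then Metric.sphere 0 1 else Metric.closedBall 0 1

/-- The measure against which the extension `f̃` is considered: `W_{μ-1/2}(y) dy` on `𝔹^{d+1}`,
and the surface measure of `𝕊^d` when `μ = 0`. -/
def liftMeasure (d : ℕ) (μ : ℝ) : Measure (E (d + 1)) :=
  open Classical in if μ = 0 then sphereMeasure (d + 1) else ballMeasure (d + 1) (μ - 1 / 2)

/-- The extension `f̃(x, x_{d+1}) = f(x)`. -/
def lift {d : ℕ} (f : E d → ℝ) (y : E (d + 1)) : ℝ :=
  f (WithLp.toLp 2 fun k : Fin d => y k.castSucc)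

/-- The space `L^p(K, ν)` for `p < ∞` and `C(K)` for `p = ∞`; `ν` is a measure carried by the
compact set `K`, and only the values of `f` on `K` matter. The norm is `eLpNorm f p ν` throughout:
for `f ∈ C(K)` and `p = ∞` this is the uniform norm on `K`, since all the measures `ν` used here
are positive on the nonempty relatively open subsets of `K`. -/
def MemSpace {n : ℕ} (p : ℝ≥0∞) (K : Set (E n)) (ν : Measure (E n)) (f : E n → ℝ) : Prop :=
  MemLp f p ν ∧ (p = ⊤ → ContinuousOn f K)

/-- `h` is the distributional derivative `D_{i,j}^r f` with respect to the rotation invariant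
measure `ν`: `∫ h g dν = (-1)^r ∫ f D_{i,j}^r g dν` for all smooth `g`. -/
def IsWeakAngDeriv {n : ℕ} (r : ℕ) (i j : Fin n) (ν : Measure (E n)) (f h : E n → ℝ) : Prop :=
  ∀ g : E n → ℝ, ContDiff ℝ ∞ g →
    ∫ x, h x * g x ∂ν = (-1 : ℝ) ^ r * ∫ x, f x * (angDeriv i j)^[r] g x ∂ν

/-- `sup_{0<|θ|≤1} |θ|^{-α} ‖Δ_{i,j,θ}^ℓ (D_{i,j}^r f)‖_{L^p(K,ν)}`, where `D_{i,j}^r f` is the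
distributional derivative. This derivative is unique up to `ν`-null sets if it exists in `L^p(K, ν)`
(in `C(K)` for `p = ∞`), so that the infimum selects it; if it does not exist there, the value
is `∞`. -/
def lipSeminorm {n : ℕ} (p : ℝ≥0∞) (r l : ℕ) (α : ℝ) (K : Set (E n)) (ν : Measure (E n))
    (i j : Fin n) (f : E n → ℝ) : ℝ≥0∞ :=
  ⨅ (h : E n → ℝ) (_ : MemSpace p K ν h ∧ IsWeakAngDeriv r i j ν f h),
    ⨆ (θ : ℝ) (_ : 0 < |θ| ∧ |θ| ≤ 1),
      eLpNorm (angDiff l i j θ h) p ν / ENNReal.ofReal (|θ| ^ α)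

/-- The norm of the Lipschitz space `𝒲_p^{r,α}(𝔹^d, W_μ)`. -/
def lipNorm (d : ℕ) (μ : ℝ) (p : ℝ≥0∞) (r l : ℕ) (α : ℝ) (f : E d → ℝ) : ℝ≥0∞ :=
  eLpNorm f p (ballMeasure d μ)
    + (⨆ (i : Fin d) (j : Fin d) (_ : i < j),
        lipSeminorm p r l α (Metric.closedBall 0 1) (ballMeasure d μ) i j f)
    + ⨆ i : Fin d,
        lipSeminorm p r l α (liftDomain d μ) (liftMeasure d μ) i.castSucc (Fin.last d) (lift f)

/-- The Lipschitz space `𝒲_p^{r,α}(𝔹^d, W_μ)`. -/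
def lipSpace (d : ℕ) (μ : ℝ) (p : ℝ≥0∞) (r l : ℕ) (α : ℝ) : Set (E d → ℝ) :=
  {f | MemSpace p (Metric.closedBall 0 1) (ballMeasure d μ) f ∧ lipNorm d μ p r l α f < ⊤}

/-- The modulus of smoothness `ω_r(f, t)_{p,μ}` on the ball. -/
def modulus (d : ℕ) (μ : ℝ) (p : ℝ≥0∞) (r : ℕ) (f : E d → ℝ) (t : ℝ) : ℝ≥0∞ :=
  ⨆ (θ : ℝ) (_ : |θ| ≤ t),
    max (⨆ (i : Fin d) (j : Fin d) (_ : i < j), eLpNorm (angDiff r i j θ f) p (ballMeasure d μ))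
      (⨆ i : Fin d,
        eLpNorm (angDiff r i.castSucc (Fin.last d) θ (lift f)) p (liftMeasure d μ))

/-- The norm of the space `H_p^{r+α}(𝔹^d, W_μ)`. -/
def holderNorm (d : ℕ) (μ : ℝ) (p : ℝ≥0∞) (r l : ℕ) (α : ℝ) (f : E d → ℝ) : ℝ≥0∞ :=
  eLpNorm f p (ballMeasure d μ)
    + ⨆ (t : ℝ) (_ : 0 < t ∧ t ≤ 1),
        modulus d μ p (r + l) f t / ENNReal.ofReal (t ^ ((r : ℝ) + α))

/-- The space `H_p^{r+α}(𝔹^d, W_μ)`. -/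
def holderSpace (d : ℕ) (μ : ℝ) (p : ℝ≥0∞) (r l : ℕ) (α : ℝ) : Set (E d → ℝ) :=
  {f | MemSpace p (Metric.closedBall 0 1) (ballMeasure d μ) f ∧ holderNorm d μ p r l α f < ⊤}

end BallLip

end

/-! For a fixed plane, the rotations act on `L^p` (or on `C(K)`) as a one-parameter group of
isometries `T_θ`. Weakly its generator is `-D_{i,j}`, and the angular difference of order `k` is `(1
- T_θ)^k`. Both inequalities are therefore proved for an abstract group, `FlowSystem`, whose
derivatives are tested against a separating family of functionals.

Direct estimate. Weakly, `(1 - T_θ) x = ∫_0^θ T_u (D x) du`. If `y = D^r x`, iterating this gives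
`‖(1 - T_θ)^(r+l) x‖ ≤ |θ|^r ‖(1 - T_θ)^l y‖` (`FlowSystem.WeakDeriv.norm_diff_pow_add_le`). Hence
the `H` norm is at most the Lipschitz norm, with constant one, also for `α = 0`.

Converse, for `0 < α < 1` (`FlowSystem.exists_weakDeriv_of_diff_le`). Let `V_n` be a Steklov average
at scale `2^(-n)`, built so that `‖x - V_n x‖` is bounded by the differences of order `r + l`, hence
is `O(2^(-n(r+α)))`. Telescoping the squares gives `x = V_0² x + ∑ (V_{n+1} + V_n)(V_{n+1} - V_n)
x`. In each term one factor takes the `r` derivatives, at cost `2^(nr)`, and the other supplies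
`2^(-n(r+α))`, so the differentiated series converges because `α > 0`. The `l`-th difference of its
`n`-th term is `O(min(2^(-nα), |θ| 2^(n(1-α))))`, and these bounds sum to `O(|θ|^α)` because `0 < α
< 1`.

It remains to realise the group on the spaces at hand. The ball and sphere measures are finite,
rotation invariant and of full support (`RotationInvariant`). The lift `f ↦ f̃` is bounded because
the lifted measure projects to a measure dominated by the one on the ball
(`exists_map_proj_liftMeasure_le`). -/

noncomputable section

namespace BallLip

/-! ### Isometry groups, weak derivatives and the direct estimate -/

/-- An isometric one-parameter group on `X` together with a separating family of functionals
along which the group is differentiable. -/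
structure FlowSystem (X S : Type*) [NormedAddCommGroup X] [NormedSpace ℝ X] where
  T : ℝ → X →L[ℝ] X
  T_zero : T 0 = 1
  T_add : ∀ s t x, T (s + t) x = T s (T t x)
  norm_T : ∀ t x, ‖T t x‖ = ‖x‖
  continuous_T : ∀ x, Continuous fun t => T t x
  pair : S → X →L[ℝ] ℝ
  D : S → S
  trans : ℝ → S → S
  pair_T : ∀ t g x, pair g (T t x) = pair (trans t g) x
  D_trans : ∀ t g, D (trans t g) = trans t (D g)
  hasDerivAt_pair : ∀ g x t, HasDerivAt (fun t => pair g (T t x)) (pair (D g) (T t x)) t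
  eq_zero : ∀ x, (∀ g, pair g x = 0) → x = 0

namespace FlowSystem

variable {X S : Type*} [NormedAddCommGroup X] [NormedSpace ℝ X] (F : FlowSystem X S)

/-- `y` is the `r`-th weak derivative of `x`, up to the sign convention of `IsWeakAngDeriv`. -/
def WeakDeriv (r : ℕ) (x y : X) : Prop :=
  ∀ g, F.pair g y = (-1 : ℝ) ^ r * F.pair (F.D^[r] g) x

/-- The first difference `1 - T_θ`. -/
def diff (θ : ℝ) : X →L[ℝ] X := 1 - F.T θ

theorem diff_apply (θ : ℝ) (x : X) : F.diff θ x = x - F.T θ x := rfl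

theorem T_comm (s t : ℝ) (x : X) : F.T s (F.T t x) = F.T t (F.T s x) := by
  rw [← F.T_add, ← F.T_add, add_comm]

theorem T_natCast_mul (θ : ℝ) (k : ℕ) : F.T (k * θ) = F.T θ ^ k := by
  induction k with
  | zero => simp [F.T_zero]
  | succ k ih =>
    ext x
    rw [pow_succ', ← ih, Nat.cast_succ, add_mul, one_mul, add_comm, F.T_add]
    rfl

theorem diff_pow_eq_sum (θ : ℝ) (k : ℕ) (x : X) :
    (F.diff θ ^ k) x
      = ∑ j ∈ Finset.range (k + 1), ((-1 : ℝ) ^ j * (k.choose j : ℝ)) • F.T (j * θ) x := by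
  have h : F.diff θ ^ k = (-(F.T θ) + 1) ^ k := by rw [diff, sub_eq_neg_add]
  rw [h, (Commute.one_right (-(F.T θ))).add_pow, sum_apply]
  refine Finset.sum_congr rfl fun j _ => ?_
  rw [F.T_natCast_mul, neg_pow, one_pow, mul_one, mul_smul]
  have e1 : ((-1 : X →L[ℝ] X) ^ j * F.T θ ^ j * (k.choose j : X →L[ℝ] X))
      = (-1 : ℝ) ^ j • (k.choose j : ℝ) • (F.T θ ^ j) := by
    rw [← neg_one_smul ℝ (1 : X →L[ℝ] X), smul_pow, one_pow, smul_mul_assoc, one_mul,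
      smul_mul_assoc, ← Nat.cast_comm, ← nsmul_eq_mul, Nat.cast_smul_eq_nsmul]
  rw [e1]
  rfl

theorem norm_diff_le (θ : ℝ) (x : X) : ‖F.diff θ x‖ ≤ 2 * ‖x‖ := by
  rw [diff_apply]
  refine (norm_sub_le _ _).trans ?_
  rw [F.norm_T, two_mul]

theorem norm_diff_pow_le (θ : ℝ) (k : ℕ) (x : X) : ‖(F.diff θ ^ k) x‖ ≤ 2 ^ k * ‖x‖ := by
  induction k generalizing x with
  | zero => simp
  | succ k ih =>
    rw [pow_succ]
    refine (ih _).trans ?_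
    rw [pow_succ, mul_assoc]
    gcongr
    exact F.norm_diff_le θ x

theorem D_iterate_trans (r : ℕ) (t : ℝ) (g : S) :
    F.D^[r] (F.trans t g) = F.trans t (F.D^[r] g) := by
  induction r with
  | zero => rfl
  | succ r ih => rw [Function.iterate_succ_apply', ih, F.D_trans, Function.iterate_succ_apply']

namespace WeakDeriv

variable {F} {r : ℕ} {x y x' y' : X}

theorem map_T (h : F.WeakDeriv r x y) (t : ℝ) : F.WeakDeriv r (F.T t x) (F.T t y) := by
  intro g
  rw [F.pair_T, h, F.pair_T, F.D_iterate_trans]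

theorem add (h : F.WeakDeriv r x y) (h' : F.WeakDeriv r x' y') :
    F.WeakDeriv r (x + x') (y + y') := by
  intro g
  rw [map_add, map_add, h, h', mul_add]

theorem sub (h : F.WeakDeriv r x y) (h' : F.WeakDeriv r x' y') :
    F.WeakDeriv r (x - x') (y - y') := by
  intro g
  rw [map_sub, map_sub, h, h', mul_sub]

theorem diff (h : F.WeakDeriv r x y) (θ : ℝ) : F.WeakDeriv r (F.diff θ x) (F.diff θ y) :=
  h.sub (h.map_T θ)

theorem diff_pow (h : F.WeakDeriv r x y) (θ : ℝ) (k : ℕ) :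
    F.WeakDeriv r ((F.diff θ ^ k) x) ((F.diff θ ^ k) y) := by
  induction k generalizing x y with
  | zero => exact h
  | succ k ih =>
    rw [pow_succ]
    exact ih (h.diff θ)

/-- The pairings are continuous, so the weak derivative is a closed operator. -/
theorem hasSum {x y : ℕ → X} {a b : X} (h : ∀ n, F.WeakDeriv r (x n) (y n)) (hx : HasSum x a)
    (hy : HasSum y b) : F.WeakDeriv r a b := by
  intro g
  have h1 := hy.mapL (F.pair g)
  have h2 := (hx.mapL (F.pair (F.D^[r] g))).mul_left ((-1 : ℝ) ^ r)
  refine h1.unique ?_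
  exact (funext fun n => h n g) ▸ h2

theorem succ_comp {k : ℕ} {z : X} (h : F.WeakDeriv r x y) (h' : F.WeakDeriv k y z) :
    F.WeakDeriv (r + k) x z := by
  intro g
  rw [h', h, Function.iterate_add_apply, pow_add]
  ring

variable [CompleteSpace X]

/-- The fundamental theorem of calculus, tested against `g`: the integrand is minus the derivative
of `u ↦ pair (D^r g) (T_u x)`, up to `(-1)^r`. One difference is exchanged for one order of
differentiation. -/
theorem integral (h : F.WeakDeriv (r + 1) x y) (θ : ℝ) :
    F.WeakDeriv r (F.diff θ x) (∫ u in (0 : ℝ)..θ, F.T u y) := by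
  intro g
  have hc : ∀ (g : S) (x : X), Continuous fun u => F.pair g (F.T u x) := fun g x =>
    (F.pair g).continuous.comp (F.continuous_T x)
  rw [← (F.pair g).intervalIntegral_comp_comm ((F.continuous_T y).intervalIntegrable _ _)]
  have h1 : ∀ u, F.pair g (F.T u y) = (-1 : ℝ) ^ (r + 1) * F.pair (F.D (F.D^[r] g)) (F.T u x) := by
    intro u
    rw [h.map_T u g, Function.iterate_succ_apply']
  simp only [h1]
  rw [intervalIntegral.integral_const_mul, intervalIntegral.integral_eq_sub_of_hasDerivAt
    (fun u _ => F.hasDerivAt_pair (F.D^[r] g) x u) ((hc _ _).intervalIntegrable _ _),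
    F.diff_apply, map_sub, F.T_zero, pow_succ]
  simp only [one_apply_eq_self]
  ring

/-- Each difference lowers the order by one and costs a factor `|θ|`, because the group is
isometric. At order zero the separating property identifies `y` with `x`. -/
theorem norm_diff_pow_le (h : F.WeakDeriv r x y) (θ : ℝ) :
    ‖(F.diff θ ^ r) x‖ ≤ |θ| ^ r * ‖y‖ := by
  induction r generalizing x y with
  | zero =>
    have : y - x = 0 := F.eq_zero _ fun g => by
      have := h g
      simp only [pow_zero, one_mul, Function.iterate_zero, id] at this
      rw [map_sub, this, sub_self]
    rw [sub_eq_zero.1 this]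
    simp
  | succ r ih =>
    rw [pow_succ (F.diff θ)]
    refine (ih (h.integral θ)).trans ?_
    rw [pow_succ, mul_assoc]
    gcongr
    refine (intervalIntegral.norm_integral_le_of_norm_le_const (C := ‖y‖) fun u _ =>
      (F.norm_T u y).le).trans ?_
    rw [sub_zero, mul_comm]

/-- The direct estimate: differences commute with weak differentiation, so the bound for `r`
differences applies to the pair of `l`-th differences. -/
theorem norm_diff_pow_add_le (h : F.WeakDeriv r x y) (l : ℕ) (θ : ℝ) :
    ‖(F.diff θ ^ (r + l)) x‖ ≤ |θ| ^ r * ‖(F.diff θ ^ l) y‖ := by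
  rw [pow_add]
  exact (h.diff_pow θ l).norm_diff_pow_le θ

end WeakDeriv

/-! ### Smoothing by convolution along the group -/

/-- The convolution operator `∫ ψ(t) T_t x dt`. -/
def conv (ψ : ℝ → ℝ) (x : X) : X := ∫ t, ψ t • F.T t x

section conv

variable {ψ χ : ℝ → ℝ}

theorem integrable_conv (hψ : Continuous ψ) (hψc : HasCompactSupport ψ)
    (x : X) : Integrable fun t => ψ t • F.T t x :=
  (hψ.smul (F.continuous_T x)).integrable_of_hasCompactSupport hψc.smul_right

theorem conv_sub (hψ : Continuous ψ) (hψc : HasCompactSupport ψ)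
    (x y : X) : F.conv ψ (x - y) = F.conv ψ x - F.conv ψ y := by
  simp only [conv, map_sub, smul_sub]
  exact integral_sub (F.integrable_conv hψ hψc x) (F.integrable_conv hψ hψc y)

theorem norm_conv_le (ψ : ℝ → ℝ) (x : X) : ‖F.conv ψ x‖ ≤ (∫ t, |ψ t|) * ‖x‖ := by
  refine (norm_integral_le_integral_norm _).trans_eq ?_
  simp only [norm_smul, F.norm_T, Real.norm_eq_abs]
  exact integral_mul_const _ _

variable [CompleteSpace X]

theorem T_conv (hψ : Continuous ψ) (hψc : HasCompactSupport ψ)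
    (t : ℝ) (x : X) : F.T t (F.conv ψ x) = F.conv ψ (F.T t x) := by
  rw [conv, ← (F.T t).integral_comp_comm (F.integrable_conv hψ hψc x)]
  simp only [map_smul, F.T_comm t]
  rfl

/-- Bundled as a bounded operator commuting with the group, one convolution passes under the
integral defining the other. Commutation is what lets the squares of averages factor in the dyadic
decomposition. -/
theorem conv_comm (hψ : Continuous ψ) (hψc : HasCompactSupport ψ)
    (hχ : Continuous χ) (hχc : HasCompactSupport χ) (x : X) :
    F.conv ψ (F.conv χ x) = F.conv χ (F.conv ψ x) := by
  let L : X →L[ℝ] X := LinearMap.mkContinuous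
    { toFun := F.conv ψ
      map_add' := fun x y => by
        have := F.conv_sub hψ hψc (x + y) y
        rw [add_sub_cancel_right] at this
        rw [this, sub_add_cancel]
      map_smul' := fun c x => by
        simp only [conv, map_smul, RingHom.id_apply]
        rw [← integral_smul]
        simp only [smul_comm c] } (∫ t, |ψ t|) (F.norm_conv_le ψ)
  have h : ∀ y, F.conv ψ y = L y := fun _ => rfl
  rw [h, conv, ← L.integral_comp_comm (F.integrable_conv hχ hχc x)]
  have e : ∀ t, L (F.T t x) = F.T t (L x) := fun t => (F.T_conv hψ hψc t x).symm
  simp only [map_smul, e]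
  rfl

/-- Integration by parts moves the derivative from the orbit of `x` to the kernel; compact support
leaves no boundary terms. -/
theorem weakDeriv_conv_deriv (hψ : ContDiff ℝ ∞ ψ) (hψc : HasCompactSupport ψ) (x : X) :
    F.WeakDeriv 1 (F.conv ψ x) (F.conv (deriv ψ) x) := by
  intro g
  have hd : Continuous (deriv ψ) := hψ.continuous_deriv (by simp)
  have hc : ∀ (g : S) (x : X), Continuous fun u => F.pair g (F.T u x) := fun g x =>
    (F.pair g).continuous.comp (F.continuous_T x)
  rw [conv, conv, ← (F.pair g).integral_comp_comm (F.integrable_conv hd hψc.deriv x),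
    ← (F.pair _).integral_comp_comm (F.integrable_conv hψ.continuous hψc x)]
  simp only [map_smul, smul_eq_mul, pow_one, Function.iterate_one, neg_mul, one_mul]
  rw [integral_mul_deriv_eq_deriv_mul_of_integrable
    (u := ψ) (u' := deriv ψ) (v := fun t => F.pair g (F.T t x))
    (v' := fun t => F.pair (F.D g) (F.T t x)), neg_neg]
  · exact fun t _ => (hψ.differentiable (by simp) t).hasDerivAt
  · exact fun t _ => F.hasDerivAt_pair g x t
  · exact (hψ.continuous.mul (hc _ _)).integrable_of_hasCompactSupport hψc.mul_right
  · exact (hd.mul (hc _ _)).integrable_of_hasCompactSupport hψc.deriv.mul_right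
  · exact (hψ.continuous.mul (hc _ _)).integrable_of_hasCompactSupport hψc.mul_right

end conv

end FlowSystem

/-! ### Derivatives and dilations of kernels -/

theorem contDiff_iterate_deriv {ψ : ℝ → ℝ} (hψ : ContDiff ℝ ∞ ψ) (r : ℕ) :
    ContDiff ℝ ∞ (deriv^[r] ψ) := by
  induction r with
  | zero => exact hψ
  | succ r ih =>
    rw [Function.iterate_succ_apply']
    exact ((contDiff_infty_iff_deriv (𝕜 := ℝ)).1 ih).2

theorem hasCompactSupport_iterate_deriv {ψ : ℝ → ℝ} (hψ : HasCompactSupport ψ) (r : ℕ) :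
    HasCompactSupport (deriv^[r] ψ) := by
  induction r with
  | zero => exact hψ
  | succ r ih =>
    rw [Function.iterate_succ_apply']
    exact ih.deriv

theorem FlowSystem.weakDeriv_conv {X S : Type*} [NormedAddCommGroup X] [NormedSpace ℝ X]
    [CompleteSpace X] (F : FlowSystem X S) {ψ : ℝ → ℝ} (hψ : ContDiff ℝ ∞ ψ)
    (hψc : HasCompactSupport ψ) (r : ℕ) (x : X) :
    F.WeakDeriv r (F.conv ψ x) (F.conv (deriv^[r] ψ) x) := by
  induction r with
  | zero => intro g; simp
  | succ r ih =>
    rw [Function.iterate_succ_apply']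
    exact ih.succ_comp (F.weakDeriv_conv_deriv (contDiff_iterate_deriv hψ r)
      (hasCompactSupport_iterate_deriv hψc r) x)

/-- The dilated kernel `ψ_s(t) = ψ(t / s) / s`. -/
def dilate (s : ℝ) (ψ : ℝ → ℝ) (t : ℝ) : ℝ := s⁻¹ * ψ (s⁻¹ * t)

theorem contDiff_dilate {ψ : ℝ → ℝ} (hψ : ContDiff ℝ ∞ ψ) (s : ℝ) : ContDiff ℝ ∞ (dilate s ψ) :=
  contDiff_const.mul (hψ.comp (contDiff_const.mul contDiff_id))

theorem hasCompactSupport_dilate {ψ : ℝ → ℝ} (hψ : HasCompactSupport ψ) {s : ℝ} (hs : 0 < s) :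
    HasCompactSupport (dilate s ψ) := by
  have : HasCompactSupport fun t => ψ (s⁻¹ • t) := hψ.comp_smul (inv_ne_zero hs.ne')
  exact this.mul_left (f := fun _ => s⁻¹)

theorem iterate_deriv_dilate {ψ : ℝ → ℝ} (hψ : ContDiff ℝ ∞ ψ) (s : ℝ) (r : ℕ) :
    deriv^[r] (dilate s ψ) = fun t => s⁻¹ ^ r * dilate s (deriv^[r] ψ) t := by
  induction r with
  | zero => simp
  | succ r ih =>
    rw [Function.iterate_succ_apply', ih]
    ext t
    have hd : DifferentiableAt ℝ (deriv^[r] ψ) (s⁻¹ * t) :=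
      (contDiff_iterate_deriv hψ r).differentiable (by simp) _
    have := ((hd.hasDerivAt.comp t ((hasDerivAt_id t).const_mul s⁻¹)).const_mul s⁻¹).const_mul
      (s⁻¹ ^ r)
    refine this.deriv.trans ?_
    rw [dilate, Function.iterate_succ_apply']
    ring

theorem integral_dilate (ψ : ℝ → ℝ) {s : ℝ} (hs : 0 < s) : ∫ t, dilate s ψ t = ∫ t, ψ t := by
  simp only [dilate]
  rw [integral_const_mul, Measure.integral_comp_mul_left, inv_inv, abs_of_pos hs, smul_eq_mul,
    inv_mul_cancel_left₀ hs.ne']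

theorem integral_abs_iterate_deriv_dilate {ψ : ℝ → ℝ} (hψ : ContDiff ℝ ∞ ψ) {s : ℝ} (hs : 0 < s)
    (r : ℕ) : ∫ t, |deriv^[r] (dilate s ψ) t| = s⁻¹ ^ r * ∫ t, |deriv^[r] ψ t| := by
  rw [iterate_deriv_dilate hψ, ← integral_dilate (fun t => |deriv^[r] ψ t|) hs,
    ← integral_const_mul]
  congr 1
  ext t
  simp only [dilate]
  rw [abs_mul, abs_mul, abs_of_nonneg (pow_nonneg (inv_nonneg.2 hs.le) r),
    abs_of_nonneg (inv_nonneg.2 hs.le)]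

/-! ### Steklov averages and dyadic summation -/

section

/-- A smooth bump supported in `[-1, 1]` with integral one. -/
theorem exists_smooth_kernel : ∃ φ : ℝ → ℝ, ContDiff ℝ ∞ φ ∧ HasCompactSupport φ ∧
    (∀ t, 0 ≤ φ t) ∧ (∀ t, φ t ≠ 0 → |t| ≤ 1) ∧ ∫ t, φ t = 1 := by
  let b : ContDiffBump (0 : ℝ) := ⟨1 / 2, 1, by norm_num, by norm_num⟩
  refine ⟨b.normed volume, b.contDiff_normed, b.hasCompactSupport_normed, b.nonneg_normed,
    fun t ht => ?_, b.integral_normed⟩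
  have : t ∈ Function.support (b.normed volume) := ht
  rw [b.support_normed_eq] at this
  simpa using (Metric.mem_ball.1 this).le

/-- The kernel for which `1 - conv` averages the differences of order `k`. -/
def steklovKernel (φ : ℝ → ℝ) (k : ℕ) (t : ℝ) : ℝ :=
  ∑ j ∈ Finset.range k, ((-1 : ℝ) ^ j * (k.choose (j + 1) : ℝ)) * dilate (j + 1) φ t

theorem contDiff_steklovKernel {φ : ℝ → ℝ} (hφ : ContDiff ℝ ∞ φ) (k : ℕ) :
    ContDiff ℝ ∞ (steklovKernel φ k) :=
  ContDiff.sum fun _ _ => contDiff_const.mul (contDiff_dilate hφ _)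

theorem hasCompactSupport_steklovKernel {φ : ℝ → ℝ} (hφ : HasCompactSupport φ) (k : ℕ) :
    HasCompactSupport (steklovKernel φ k) := by
  have : steklovKernel φ k = ∑ j ∈ Finset.range k,
      fun t => ((-1 : ℝ) ^ j * (k.choose (j + 1) : ℝ)) * dilate (j + 1) φ t := by
    ext t; simp [steklovKernel]
  rw [this]
  refine Finset.sum_induction _ HasCompactSupport (fun _ _ => HasCompactSupport.add)
    HasCompactSupport.zero fun j _ => ?_
  exact (hasCompactSupport_dilate hφ (by positivity)).mul_left
    (f := fun _ => ((-1 : ℝ) ^ j * (k.choose (j + 1) : ℝ)))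

variable {X S : Type*} [NormedAddCommGroup X] [NormedSpace ℝ X] (F : FlowSystem X S)

theorem FlowSystem.integral_smul_T_mul {φ : ℝ → ℝ} {s c : ℝ} (hc : 0 < c) (x : X) :
    ∫ t, dilate s φ t • F.T (c * t) x = F.conv (dilate s (dilate c φ)) x := by
  have h := Measure.integral_comp_mul_left (fun t => dilate s (dilate c φ) t • F.T t x) c
  rw [FlowSystem.conv, ← smul_inv_smul₀ hc.ne' (∫ t, dilate s (dilate c φ) t • F.T t x)]
  rw [abs_of_pos (inv_pos.2 hc)] at h
  rw [← h, ← integral_smul]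
  congr 1
  ext t
  rw [smul_smul]
  congr 1
  simp only [dilate]
  rw [show c⁻¹ * (s⁻¹ * (c * t)) = s⁻¹ * t by field_simp]
  field_simp

/-- Expand `(1 - T_t)^k` binomially. The term `j = 0` integrates to `x` because `φ` has mass one;
the substitution `t ↦ (j + 1) t` turns the term `j + 1` into a convolution with a dilated kernel,
and together these form minus the Steklov average. -/
theorem FlowSystem.sub_conv_steklovKernel {φ : ℝ → ℝ} (hφ : ContDiff ℝ ∞ φ)
    (hφc : HasCompactSupport φ) (hφ1 : ∫ t, φ t = 1) [CompleteSpace X] (k : ℕ) {s : ℝ}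
    (hs : 0 < s) (x : X) :
    x - F.conv (dilate s (steklovKernel φ k)) x = ∫ t, dilate s φ t • (F.diff t ^ k) x := by
  have hi : ∀ c : ℝ, Integrable fun t => dilate s φ t • F.T (c * t) x := fun c =>
    ((contDiff_dilate hφ s).continuous.smul ((F.continuous_T x).comp
      (continuous_const.mul continuous_id))).integrable_of_hasCompactSupport
      (hasCompactSupport_dilate hφc hs).smul_right
  have e1 : ∀ t, dilate s φ t • (F.diff t ^ k) x = ∑ j ∈ Finset.range (k + 1),
      ((-1 : ℝ) ^ j * (k.choose j : ℝ)) • (dilate s φ t • F.T (j * t) x) := fun t => by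
    rw [F.diff_pow_eq_sum, Finset.smul_sum]
    exact Finset.sum_congr rfl fun j _ => smul_comm _ _ _
  simp only [e1]
  have e3 := integral_finsetSum (μ := volume) (Finset.range (k + 1)) fun j _ =>
    (hi j).fun_smul ((-1 : ℝ) ^ j * (k.choose j : ℝ))
  rw [e3, Finset.sum_range_succ']
  simp only [integral_smul]
  have e0 : ∫ t, dilate s φ t • F.T (((0 : ℕ) : ℝ) * t) x = x := by
    simp only [Nat.cast_zero, zero_mul, F.T_zero, one_apply_eq_self]
    rw [integral_smul_const, integral_dilate φ hs, hφ1, one_smul]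
  rw [e0]
  have e2 : F.conv (dilate s (steklovKernel φ k)) x = ∑ j ∈ Finset.range k,
      ((-1 : ℝ) ^ j * (k.choose (j + 1) : ℝ)) • ∫ t, dilate s φ t • F.T ((j + 1 : ℝ) * t) x := by
    have : ∀ t, dilate s (steklovKernel φ k) t • F.T t x = ∑ j ∈ Finset.range k,
        ((-1 : ℝ) ^ j * (k.choose (j + 1) : ℝ)) •
          (dilate s (dilate (j + 1) φ) t • F.T t x) := fun t => by
      simp only [steklovKernel, dilate, Finset.mul_sum, Finset.sum_smul, smul_smul]
      refine Finset.sum_congr rfl fun j _ => ?_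
      congr 1
      ring
    simp only [FlowSystem.conv, this]
    rw [integral_finsetSum]
    · refine Finset.sum_congr rfl fun j _ => ?_
      rw [integral_smul, F.integral_smul_T_mul (by positivity)]
      rfl
    · intro j _
      exact (F.integrable_conv (contDiff_dilate (contDiff_dilate hφ _) _).continuous
        (hasCompactSupport_dilate (hasCompactSupport_dilate hφc (by positivity)) hs) x).smul _
  rw [e2]
  simp only [pow_zero, Nat.choose_zero_right, Nat.cast_one, mul_one, one_smul, Nat.cast_add]
  rw [sub_eq_add_neg, add_comm, ← Finset.sum_neg_distrib]
  congr 1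
  refine Finset.sum_congr rfl fun j _ => ?_
  rw [← neg_smul, pow_succ]
  congr 1
  ring

/-- The error is a mean of differences against a probability density supported in `|t| ≤ s`. -/
theorem FlowSystem.norm_sub_conv_steklovKernel_le {φ : ℝ → ℝ} (hφ : ContDiff ℝ ∞ φ)
    (hφc : HasCompactSupport φ) (hφ0 : ∀ t, 0 ≤ φ t) (hφs : ∀ t, φ t ≠ 0 → |t| ≤ 1)
    (hφ1 : ∫ t, φ t = 1) [CompleteSpace X] (k : ℕ) {s B : ℝ} (hs : 0 < s) (x : X)
    (hB : ∀ t, |t| ≤ s → ‖(F.diff t ^ k) x‖ ≤ B) :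
    ‖x - F.conv (dilate s (steklovKernel φ k)) x‖ ≤ B := by
  rw [F.sub_conv_steklovKernel hφ hφc hφ1 k hs]
  have hd := (contDiff_dilate hφ s).continuous
  have hdc := hasCompactSupport_dilate hφc hs
  have : ∀ t, ‖dilate s φ t • (F.diff t ^ k) x‖ ≤ dilate s φ t * B := fun t => by
    rw [norm_smul]
    have h0 : 0 ≤ dilate s φ t := mul_nonneg (inv_nonneg.2 hs.le) (hφ0 _)
    rw [Real.norm_of_nonneg h0]
    by_cases ht : φ (s⁻¹ * t) = 0
    · simp [dilate, ht]
    · have := hφs _ ht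
      rw [abs_mul, abs_of_pos (inv_pos.2 hs), inv_mul_le_iff₀ hs, mul_one] at this
      exact mul_le_mul_of_nonneg_left (hB t this) h0
  refine (norm_integral_le_of_norm_le ?_ (Filter.Eventually.of_forall this)).trans_eq ?_
  · exact (hd.integrable_of_hasCompactSupport hdc).mul_const _
  · rw [integral_mul_const, integral_dilate φ hs, hφ1, one_mul]

/-- Summation of the dyadic bounds. -/
theorem exists_dyadic_sum_bound {α : ℝ} (h0 : 0 < α) (h1 : α < 1) :
    ∃ C : ℝ, 0 ≤ C ∧ ∀ θ : ℝ, 0 < θ → θ ≤ 1 → ∀ a : ℕ → ℝ, (∀ n, 0 ≤ a n) →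
      (∀ n, a n ≤ (((1 / 2 : ℝ) ^ n) ^ α)) →
      (∀ n, a n ≤ θ * ((1 / 2 : ℝ) ^ n) ^ (α - 1)) → Summable a ∧ ∑' n, a n ≤ C * θ ^ α := by
  set q : ℝ := (1 / 2 : ℝ) ^ α with hq
  set ρ : ℝ := (1 / 2 : ℝ) ^ (1 - α) with hρ
  have hq0 : 0 < q := by positivity
  have hρ0 : 0 < ρ := by positivity
  have hq1 : q < 1 := Real.rpow_lt_one (by norm_num) (by norm_num) h0
  have hρ1 : ρ < 1 := Real.rpow_lt_one (by norm_num) (by norm_num) (by linarith)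
  have hpow : ∀ n : ℕ, ((1 / 2 : ℝ) ^ n) ^ α = q ^ n := fun n => by
    rw [hq, ← Real.rpow_natCast, ← Real.rpow_natCast, ← Real.rpow_mul (by norm_num),
      ← Real.rpow_mul (by norm_num), mul_comm]
  have hpow' : ∀ n : ℕ, ((1 / 2 : ℝ) ^ n) ^ (1 - α) = ρ ^ n := fun n => by
    rw [hρ, ← Real.rpow_natCast, ← Real.rpow_natCast, ← Real.rpow_mul (by norm_num),
      ← Real.rpow_mul (by norm_num), mul_comm]
  refine ⟨(1 - ρ)⁻¹ + (1 - q)⁻¹, by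
    have := sub_pos.2 hρ1; have := sub_pos.2 hq1; positivity, ?_⟩
  intro θ hθ0 hθ1 a ha ha1 ha2
  have hsum : Summable a := by
    refine Summable.of_nonneg_of_le ha (fun n => (ha1 n).trans_eq (hpow n)) ?_
    exact summable_geometric_of_lt_one hq0.le hq1
  refine ⟨hsum, ?_⟩
  -- `N` is the dyadic level of `θ`: `2^(-(N+1)) < θ ≤ 2^(-N)`. Up to `N` the bound with the factor
  -- `θ` grows geometrically with `n`, beyond `N` the other one decays, so both sums are dominated
  -- by their terms near `N`, of size `θ^α`.
  obtain ⟨N, hN1, hN2⟩ := exists_nat_pow_near_of_lt_one hθ0 hθ1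
    (by norm_num : (0 : ℝ) < 1 / 2) (by norm_num : (1 / 2 : ℝ) < 1)
  have hθα : 0 < θ ^ α := Real.rpow_pos_of_pos hθ0 _
  rw [← hsum.sum_add_tsum_nat_add (N + 1), add_mul]
  refine add_le_add ?_ ?_
  · have : ∀ n ∈ Finset.range (N + 1), a n ≤ ρ ^ (N + 1 - 1 - n) * θ ^ α := fun n hn => by
      have hn' : n ≤ N := Nat.lt_succ_iff.1 (Finset.mem_range.1 hn)
      refine (ha2 n).trans ?_
      have e1 : ((1 / 2 : ℝ) ^ n) ^ (α - 1) = (ρ ^ n)⁻¹ := by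
        rw [← hpow', ← Real.rpow_neg (by positivity), neg_sub]
      have e2 : θ ^ (1 - α) ≤ ρ ^ N := by
        rw [← hpow']
        exact Real.rpow_le_rpow hθ0.le hN2 (by linarith)
      have e3 : θ = θ ^ (1 - α) * θ ^ α := by
        rw [← Real.rpow_add hθ0]; simp
      have e4 : ρ ^ (N + 1 - 1 - n) = ρ ^ N * (ρ ^ n)⁻¹ := by
        rw [Nat.add_sub_cancel, pow_sub₀ _ hρ0.ne' hn']
      rw [e1, e4]
      calc θ * (ρ ^ n)⁻¹ = θ ^ (1 - α) * ((ρ ^ n)⁻¹ * θ ^ α) := by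
            nth_rewrite 1 [e3]; ring
        _ ≤ ρ ^ N * ((ρ ^ n)⁻¹ * θ ^ α) := by gcongr
        _ = _ := by ring
    refine (Finset.sum_le_sum this).trans ?_
    rw [← Finset.sum_mul, Finset.sum_range_reflect (fun n => ρ ^ n)]
    gcongr
    rw [← tsum_geometric_of_lt_one hρ0.le hρ1]
    exact (summable_geometric_of_lt_one hρ0.le hρ1).sum_le_tsum _ fun _ _ => by positivity
  · have : ∀ n, a (n + (N + 1)) ≤ q ^ n * θ ^ α := fun n => by
      refine (ha1 _).trans ?_
      rw [hpow, pow_add]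
      gcongr
      rw [← hpow]
      exact Real.rpow_le_rpow (by positivity) hN1.le h0.le
    have hg : Summable fun n => q ^ n * θ ^ α :=
      (summable_geometric_of_lt_one hq0.le hq1).mul_right _
    refine ((hsum.comp_injective (add_left_injective (N + 1))).tsum_le_tsum this hg).trans ?_
    rw [tsum_mul_right, tsum_geometric_of_lt_one hq0.le hq1]

end

/-! ### The converse estimate by dyadic decomposition -/

/-- For `|θ| ≥ s` the trivial bound `2^l` on the differences is used. For `|θ| ≤ s` the `l`
differences are traded for `l` further derivatives of the kernel, each at the cost `|θ| / s`, and
`(|θ| / s)^l ≤ |θ| / s` since `l ≥ 1`. -/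
theorem FlowSystem.norm_diff_pow_conv_iterate_deriv_le {X S : Type*} [NormedAddCommGroup X]
    [NormedSpace ℝ X] [CompleteSpace X] (F : FlowSystem X S) {ψ : ℝ → ℝ} (hψ : ContDiff ℝ ∞ ψ)
    (hψc : HasCompactSupport ψ) (r l : ℕ) (hl : 1 ≤ l) {s θ : ℝ} (hs : 0 < s) (z : X) :
    ‖(F.diff θ ^ l) (F.conv (deriv^[r] (dilate s ψ)) z)‖
      ≤ (2 ^ l * (∫ t, |deriv^[r] ψ t|) + ∫ t, |deriv^[l + r] ψ t|) * s⁻¹ ^ r * ‖z‖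
        * min 1 (|θ| / s) := by
  set M₁ := ∫ t, |deriv^[r] ψ t| with hM₁
  set M₂ := ∫ t, |deriv^[l + r] ψ t| with hM₂
  have h1 : 0 ≤ M₁ := integral_nonneg fun _ => abs_nonneg _
  have h2 : 0 ≤ M₂ := integral_nonneg fun _ => abs_nonneg _
  have hψs := contDiff_dilate hψ s
  have hψsc := hasCompactSupport_dilate hψc hs
  have b1 : ‖(F.diff θ ^ l) (F.conv (deriv^[r] (dilate s ψ)) z)‖
      ≤ 2 ^ l * (s⁻¹ ^ r * M₁ * ‖z‖) := by
    refine (F.norm_diff_pow_le _ _ _).trans ?_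
    gcongr
    rw [hM₁, ← integral_abs_iterate_deriv_dilate hψ hs]
    exact F.norm_conv_le _ _
  have b2 : ‖(F.diff θ ^ l) (F.conv (deriv^[r] (dilate s ψ)) z)‖
      ≤ |θ| ^ l * (s⁻¹ ^ (l + r) * M₂ * ‖z‖) := by
    refine ((F.weakDeriv_conv (contDiff_iterate_deriv hψs r)
      (hasCompactSupport_iterate_deriv hψsc r) l z).norm_diff_pow_le θ).trans ?_
    gcongr
    rw [hM₂, ← integral_abs_iterate_deriv_dilate hψ hs, Function.iterate_add_apply]
    exact F.norm_conv_le _ _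
  have hz := norm_nonneg z
  rcases le_total |θ| s with h | h
  · have hu : |θ| / s ≤ 1 := (div_le_one hs).2 h
    rw [min_eq_right hu]
    refine b2.trans ?_
    have e : |θ| ^ l * (s⁻¹ ^ (l + r) * M₂ * ‖z‖) = M₂ * s⁻¹ ^ r * ‖z‖ * (|θ| / s) ^ l := by
      rw [pow_add, div_eq_mul_inv, mul_pow]; ring
    rw [e]
    have : (|θ| / s) ^ l ≤ |θ| / s := pow_le_of_le_one (by positivity) hu (by omega)
    gcongr
    have : 0 ≤ 2 ^ l * M₁ := by positivity
    linarith
  · rw [min_eq_left ((one_le_div hs).2 h), mul_one]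
    refine b1.trans ?_
    have : 0 ≤ M₂ * s⁻¹ ^ r * ‖z‖ := by positivity
    nlinarith

/-- The constant is chosen before the group, so that a single one serves all coordinate planes. -/
theorem FlowSystem.exists_weakDeriv_of_diff_le (X S : Type*) [NormedAddCommGroup X]
    [NormedSpace ℝ X] [CompleteSpace X] (r l : ℕ) (hl : 1 ≤ l) {α : ℝ} (hα0 : 0 < α)
    (hα1 : α < 1) :
    ∃ C : ℝ, 0 ≤ C ∧ ∀ (F : FlowSystem X S) (x : X) (A : ℝ), 0 ≤ A →
      (∀ t, |t| ≤ 1 → ‖(F.diff t ^ (r + l)) x‖ ≤ A * |t| ^ ((r : ℝ) + α)) →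
      ∃ y, F.WeakDeriv r x y ∧
        ∀ θ, 0 < |θ| → |θ| ≤ 1 → ‖(F.diff θ ^ l) y‖ ≤ C * (A + ‖x‖) * |θ| ^ α := by
  obtain ⟨φ, hφ, hφc, hφ0, hφs, hφ1⟩ := exists_smooth_kernel
  obtain ⟨C₀, hC₀, hsumC⟩ := exists_dyadic_sum_bound hα0 hα1
  set ψ := steklovKernel φ (r + l) with hψdef
  have hψ : ContDiff ℝ ∞ ψ := contDiff_steklovKernel hφ _
  have hψc : HasCompactSupport ψ := hasCompactSupport_steklovKernel hφc _
  set M₀ := ∫ t, |ψ t| with hM₀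
  set M₁ := ∫ t, |deriv^[r] ψ t| with hM₁
  set M := 2 ^ l * M₁ + ∫ t, |deriv^[l + r] ψ t| with hM
  have hM₀0 : 0 ≤ M₀ := integral_nonneg fun _ => abs_nonneg _
  have hM₁0 : 0 ≤ M₁ := integral_nonneg fun _ => abs_nonneg _
  have hM0 : 0 ≤ M := add_nonneg (by positivity) (integral_nonneg fun _ => abs_nonneg _)
  -- `M * M₀` comes from the initial term `V_0² x`. In `2^(r+3)`, `2^r` and one factor 2 come from
  -- passing from scale `s (n+1)` to `s n`, one from the two summands of `ys n`, and one from the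
  -- bound on `z n`.
  refine ⟨M * M₀ + M * 2 ^ (r + 3) * C₀, by positivity, ?_⟩
  intro F x A hA hx
  let s : ℕ → ℝ := fun n => (1 / 2 : ℝ) ^ n
  have hs : ∀ n, 0 < s n := fun n => by positivity
  have hs1 : ∀ n, s n ≤ 1 := fun n => pow_le_one₀ (by norm_num) (by norm_num)
  have hss : ∀ n, (s (n + 1))⁻¹ = 2 * (s n)⁻¹ := fun n => by
    simp only [s, pow_succ]; field_simp
  let V : ℕ → X → X := fun n z => F.conv (dilate (s n) ψ) z
  let W : ℕ → X → X := fun n z => F.conv (deriv^[r] (dilate (s n) ψ)) z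
  have hc : ∀ n, Continuous (dilate (s n) ψ) := fun n => (contDiff_dilate hψ _).continuous
  have hcc : ∀ n, HasCompactSupport (dilate (s n) ψ) := fun n => hasCompactSupport_dilate hψc (hs n)
  have hVW : ∀ n z, F.WeakDeriv r (V n z) (W n z) := fun n z =>
    F.weakDeriv_conv (contDiff_dilate hψ _) (hcc n) r z
  have hV : ∀ n z, ‖V n z‖ ≤ M₀ * ‖z‖ := fun n z => by
    have := integral_abs_iterate_deriv_dilate hψ (hs n) 0
    simp only [Function.iterate_zero, id, pow_zero, one_mul] at this
    rw [hM₀, ← this]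
    exact F.norm_conv_le _ _
  have hW : ∀ n z, ‖W n z‖ ≤ (s n)⁻¹ ^ r * M₁ * ‖z‖ := fun n z => by
    rw [hM₁, ← integral_abs_iterate_deriv_dilate hψ (hs n)]
    exact F.norm_conv_le _ _
  have hWd : ∀ n z θ, ‖(F.diff θ ^ l) (W n z)‖ ≤ M * (s n)⁻¹ ^ r * ‖z‖ * min 1 (|θ| / s n) :=
    fun n z θ => F.norm_diff_pow_conv_iterate_deriv_le hψ hψc r l hl (hs n) z
  have hVx : ∀ n, ‖x - V n x‖ ≤ A * s n ^ ((r : ℝ) + α) := fun n =>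
    F.norm_sub_conv_steklovKernel_le hφ hφc hφ0 hφs hφ1 (r + l) (hs n) x fun t ht =>
      (hx t (ht.trans (hs1 n))).trans (by gcongr)
  let z : ℕ → X := fun n => V (n + 1) x - V n x
  have hz : ∀ n, ‖z n‖ ≤ 2 * A * s n ^ ((r : ℝ) + α) := fun n => by
    have e : z n = (x - V n x) - (x - V (n + 1) x) := by simp only [z]; abel
    have h1 : A * s (n + 1) ^ ((r : ℝ) + α) ≤ A * s n ^ ((r : ℝ) + α) := by
      have : s (n + 1) ≤ s n := pow_le_pow_of_le_one (by norm_num) (by norm_num) n.le_succ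
      have := (hs (n + 1)).le
      gcongr
    rw [e]
    refine (norm_sub_le _ _).trans ?_
    linarith [hVx n, hVx (n + 1)]
  have hzs : ∀ n, (s n)⁻¹ ^ r * ‖z n‖ ≤ 2 * A * s n ^ α := fun n => by
    have e : s n ^ ((r : ℝ) + α) = s n ^ r * s n ^ α := by
      rw [Real.rpow_add (hs n), Real.rpow_natCast]
    calc (s n)⁻¹ ^ r * ‖z n‖ ≤ (s n)⁻¹ ^ r * (2 * A * s n ^ ((r : ℝ) + α)) := by
          have := hs n
          gcongr
          exact hz n
      _ = 2 * A * s n ^ α := by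
          rw [e, inv_pow]
          have := (pow_pos (hs n) r).ne'
          field_simp
  have hsα : Summable fun n => s n ^ α := by
    have e : ∀ n, s n ^ α = ((1 / 2 : ℝ) ^ α) ^ n := fun n => by
      simp only [s]
      rw [← Real.rpow_natCast, ← Real.rpow_natCast, ← Real.rpow_mul (by norm_num),
        ← Real.rpow_mul (by norm_num), mul_comm]
    simp only [e]
    exact summable_geometric_of_lt_one (by positivity)
      (Real.rpow_lt_one (by norm_num) (by norm_num) hα0)
  have hsr : ∀ n, s n ^ ((r : ℝ) + α) ≤ s n ^ α := fun n =>
    Real.rpow_le_rpow_of_exponent_ge (hs n) (hs1 n)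
      (by linarith [(Nat.cast_nonneg r : (0 : ℝ) ≤ r)])
  -- `V_{n+1}² - V_n² = (V_{n+1} + V_n)(V_{n+1} - V_n)`: the sum factor is differentiated to give
  -- `ys n`, the difference factor `z n` is small.
  let xs : ℕ → X := fun n => V (n + 1) (z n) + V n (z n)
  let ys : ℕ → X := fun n => W (n + 1) (z n) + W n (z n)
  have hxy : ∀ n, F.WeakDeriv r (xs n) (ys n) := fun n => (hVW _ _).add (hVW _ _)
  have hxs : ∀ n, xs n = V (n + 1) (V (n + 1) x) - V n (V n x) := fun n => by
    have h1 : ∀ m, V m (z n) = V m (V (n + 1) x) - V m (V n x) := fun m =>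
      F.conv_sub (hc m) (hcc m) _ _
    have h2 : V (n + 1) (V n x) = V n (V (n + 1) x) := F.conv_comm (hc _) (hcc _) (hc _) (hcc _) x
    simp only [xs, h1, h2]
    abel
  have hxsum : HasSum xs (x - V 0 (V 0 x)) := by
    have hS : Summable xs := by
      refine Summable.of_norm_bounded (hsα.mul_left (2 * M₀ * (2 * A))) fun n => ?_
      refine (norm_add_le _ _).trans ?_
      have h1 : ‖z n‖ ≤ 2 * A * s n ^ α := (hz n).trans
        (mul_le_mul_of_nonneg_left (hsr n) (by positivity))
      have h2 := mul_le_mul_of_nonneg_left h1 hM₀0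
      linarith [hV (n + 1) (z n), hV n (z n)]
    rw [hS.hasSum_iff_tendsto_nat]
    simp only [hxs]
    simp only [Finset.sum_range_sub fun n => V n (V n x)]
    refine Filter.Tendsto.sub_const ?_ _
    rw [tendsto_iff_norm_sub_tendsto_zero]
    -- `V_n² x → x` because `V_n² x - x = -V_n (x - V_n x) - (x - V_n x)` and the `V_n` are
    -- uniformly bounded by `M₀`.
    refine squeeze_zero (fun _ => norm_nonneg _) (g := fun n => (M₀ + 1) * A * s n ^ α)
      (fun n => ?_) ?_
    · have e : V n (V n x) - x = -(V n (x - V n x)) - (x - V n x) := by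
        have : V n (x - V n x) = V n x - V n (V n x) := F.conv_sub (hc n) (hcc n) _ _
        rw [this]; abel
      rw [e]
      refine (norm_sub_le _ _).trans ?_
      rw [norm_neg]
      have h1 : ‖x - V n x‖ ≤ A * s n ^ α := (hVx n).trans
        (mul_le_mul_of_nonneg_left (hsr n) (by positivity))
      have h2 := mul_le_mul_of_nonneg_left h1 hM₀0
      linarith [hV n (x - V n x)]
    · simpa using hsα.tendsto_atTop_zero.const_mul ((M₀ + 1) * A)
  have hbase : ∀ n, (s (n + 1))⁻¹ ^ r = 2 ^ r * (s n)⁻¹ ^ r := fun n => by rw [hss, mul_pow]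
  have hysum : Summable ys := by
    refine Summable.of_norm_bounded (hsα.mul_left ((2 ^ r + 1) * M₁ * (2 * A))) fun n => ?_
    refine (norm_add_le _ _).trans ?_
    have h1 := hW (n + 1) (z n)
    have h2 := hW n (z n)
    rw [hbase] at h1
    have h3 := mul_le_mul_of_nonneg_left (hzs n) (by positivity : 0 ≤ (2 ^ r + 1) * M₁)
    linarith
  refine ⟨W 0 (V 0 x) + ∑' n, ys n, ?_, ?_⟩
  · have := (hVW 0 (V 0 x)).add (FlowSystem.WeakDeriv.hasSum hxy hxsum hysum.hasSum)
    rwa [add_sub_cancel] at this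
  · intro θ hθ0 hθ1
    have hyd : ∀ n, ‖(F.diff θ ^ l) (ys n)‖
        ≤ M * 2 ^ (r + 3) * A * min (s n ^ α) (|θ| * s n ^ (α - 1)) := fun n => by
      rw [map_add]
      refine (norm_add_le _ _).trans ?_
      set m := min 1 (|θ| / s n) with hm
      have hm0 : 0 ≤ m := le_min zero_le_one (by have := hs n; positivity)
      have hm' : min 1 (|θ| / s (n + 1)) ≤ 2 * m := by
        rw [div_eq_mul_inv, hss, hm, mul_min_of_nonneg _ _ zero_le_two]
        refine min_le_min (by norm_num) (le_of_eq ?_)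
        rw [div_eq_mul_inv]; ring
      have e1 : min (s n ^ α) (|θ| * s n ^ (α - 1)) = s n ^ α * m := by
        rw [hm, mul_min_of_nonneg _ _ (Real.rpow_nonneg (hs n).le _), mul_one,
          Real.rpow_sub_one (hs n).ne']
        congr 1
        ring
      have h1 := hWd (n + 1) (z n) θ
      have h2 := hWd n (z n) θ
      have hzn := norm_nonneg (z n)
      have hsn := hs n
      have h3 : ‖(F.diff θ ^ l) (W (n + 1) (z n))‖
          ≤ M * (2 ^ r * (s n)⁻¹ ^ r) * ‖z n‖ * (2 * m) := by
        rw [← hbase]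
        refine h1.trans ?_
        have := hs (n + 1)
        gcongr
      have h4 : M * (s n)⁻¹ ^ r * ‖z n‖ * m ≤ M * (2 ^ r * (s n)⁻¹ ^ r) * ‖z n‖ * (2 * m) := by
        have e : M * (2 ^ r * (s n)⁻¹ ^ r) * ‖z n‖ * (2 * m)
            = (2 ^ r * 2) * (M * (s n)⁻¹ ^ r * ‖z n‖ * m) := by ring
        rw [e]
        refine le_mul_of_one_le_left (by positivity) ?_
        have : (1 : ℝ) ≤ 2 ^ r := one_le_pow₀ (by norm_num)
        linarith
      rw [e1]
      calc _ ≤ 2 * (M * (2 ^ r * (s n)⁻¹ ^ r) * ‖z n‖ * (2 * m)) := by linarith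
        _ = M * 2 ^ (r + 2) * m * ((s n)⁻¹ ^ r * ‖z n‖) := by ring
        _ ≤ M * 2 ^ (r + 2) * m * (2 * A * s n ^ α) :=
            mul_le_mul_of_nonneg_left (hzs n) (by positivity)
        _ = _ := by ring
    obtain ⟨hb1, hb2⟩ := hsumC |θ| hθ0 hθ1 (fun n => min (s n ^ α) (|θ| * s n ^ (α - 1)))
      (fun n => le_min (Real.rpow_nonneg (hs n).le _)
        (mul_nonneg (abs_nonneg _) (Real.rpow_nonneg (hs n).le _)))
      (fun n => min_le_left _ _) (fun n => min_le_right _ _)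
    rw [map_add, (F.diff θ ^ l).map_tsum hysum]
    have hn : Summable fun n => ‖(F.diff θ ^ l) (ys n)‖ :=
      Summable.of_nonneg_of_le (fun _ => norm_nonneg _) hyd (hb1.mul_left _)
    have k1 : ‖∑' n, (F.diff θ ^ l) (ys n)‖ ≤ M * 2 ^ (r + 3) * A * (C₀ * |θ| ^ α) := by
      refine (norm_tsum_le_tsum_norm hn).trans ((hn.tsum_le_tsum hyd (hb1.mul_left _)).trans ?_)
      rw [tsum_mul_left]
      gcongr
    have k2 : ‖(F.diff θ ^ l) (W 0 (V 0 x))‖ ≤ M * (M₀ * ‖x‖) * |θ| ^ α := by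
      have h1 := hWd 0 (V 0 x) θ
      simp only [s, pow_zero, inv_one, one_pow, mul_one, div_one] at h1
      refine h1.trans ?_
      have h2 : min 1 |θ| ≤ |θ| ^ α := (min_le_right _ _).trans (by
        nth_rewrite 1 [← Real.rpow_one |θ|]
        exact Real.rpow_le_rpow_of_exponent_ge hθ0 hθ1 hα1.le)
      gcongr
      exact hV 0 x
    refine (norm_add_le _ _).trans ((add_le_add k2 k1).trans ?_)
    have hθα : 0 ≤ |θ| ^ α := by positivity
    have p1 : 0 ≤ M * M₀ * A * |θ| ^ α := by positivity
    have p2 : 0 ≤ M * 2 ^ (r + 3) * C₀ * ‖x‖ * |θ| ^ α := by positivity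
    linarith

/-! ### Rotations in coordinate planes -/

section planeRotation

variable {n : ℕ} {i j : Fin n}

theorem planeRotation_apply (t : ℝ) (x : E n) (k : Fin n) :
    planeRotation i j t x k = if k = i then x i * Real.cos t - x j * Real.sin t
      else if k = j then x i * Real.sin t + x j * Real.cos t else x k := rfl

theorem planeRotation_zero (x : E n) : planeRotation i j 0 x = x := by
  ext k
  rw [planeRotation_apply]
  split_ifs with h1 h2
  · simp [h1]
  · simp [h2]
  · rfl

theorem planeRotation_add (hij : i ≠ j) (s t : ℝ) (x : E n) :
    planeRotation i j (s + t) x = planeRotation i j s (planeRotation i j t x) := by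
  ext k
  simp only [planeRotation_apply, Real.cos_add, Real.sin_add, if_true, if_neg hij.symm]
  split_ifs <;> ring

theorem planeRotation_neg_cancel (hij : i ≠ j) (t : ℝ) (x : E n) :
    planeRotation i j (-t) (planeRotation i j t x) = x := by
  rw [← planeRotation_add hij, neg_add_cancel, planeRotation_zero]

theorem planeRotation_cancel_neg (hij : i ≠ j) (t : ℝ) (x : E n) :
    planeRotation i j t (planeRotation i j (-t) x) = x := by
  rw [← planeRotation_add hij, add_neg_cancel, planeRotation_zero]

theorem norm_planeRotation (hij : i ≠ j) (t : ℝ) (x : E n) : ‖planeRotation i j t x‖ = ‖x‖ := by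
  rw [← sq_eq_sq₀ (norm_nonneg _) (norm_nonneg _), EuclideanSpace.real_norm_sq_eq,
    EuclideanSpace.real_norm_sq_eq]
  rw [← Finset.add_sum_erase _ _ (Finset.mem_univ i), ← Finset.add_sum_erase _ _
    (Finset.mem_erase.2 ⟨hij.symm, Finset.mem_univ j⟩)]
  rw [← Finset.add_sum_erase _ (fun k => x k ^ 2) (Finset.mem_univ i), ← Finset.add_sum_erase _
    (fun k => x k ^ 2) (Finset.mem_erase.2 ⟨hij.symm, Finset.mem_univ j⟩)]
  have : ∑ k ∈ (Finset.univ.erase i).erase j, planeRotation i j t x k ^ 2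
      = ∑ k ∈ (Finset.univ.erase i).erase j, x k ^ 2 := by
    refine Finset.sum_congr rfl fun k hk => ?_
    simp only [Finset.mem_erase] at hk
    rw [planeRotation_apply, if_neg hk.2.1, if_neg hk.1]
  rw [this]
  simp only [planeRotation_apply, if_true, if_neg hij.symm]
  nlinarith [Real.sin_sq_add_cos_sq t]

/-- The rotation as a linear isometry equivalence. -/
def planeRotationEquiv (hij : i ≠ j) (t : ℝ) : E n ≃ₗᵢ[ℝ] E n where
  toFun := planeRotation i j t
  invFun := planeRotation i j (-t)
  left_inv := planeRotation_neg_cancel hij t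
  right_inv := planeRotation_cancel_neg hij t
  map_add' x y := by
    ext k
    simp only [planeRotation_apply, PiLp.add_apply]
    split_ifs <;> ring
  map_smul' c x := by
    ext k
    simp only [planeRotation_apply, PiLp.smul_apply, smul_eq_mul, RingHom.id_apply]
    split_ifs <;> ring
  norm_map' x := norm_planeRotation hij t x

theorem continuous_planeRotation_uncurry :
    Continuous fun q : ℝ × E n => planeRotation i j q.1 q.2 := by
  refine (PiLp.continuous_toLp 2 _).comp (continuous_pi fun k => ?_)
  split_ifs <;> fun_prop

theorem continuous_planeRotation (t : ℝ) : Continuous (planeRotation (n := n) i j t) :=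
  continuous_planeRotation_uncurry.comp (Continuous.prodMk_right t)

theorem contDiff_planeRotation (hij : i ≠ j) (t : ℝ) :
    ContDiff ℝ ∞ (planeRotation (n := n) i j t) :=
  (planeRotationEquiv hij t).contDiff

theorem hasDerivAt_planeRotation (hij : i ≠ j) (x : E n) (t : ℝ) :
    HasDerivAt (fun t => planeRotation i j t x)
      (planeRotation i j t x i • EuclideanSpace.single j 1
        - planeRotation i j t x j • EuclideanSpace.single i 1) t := by
  rw [hasDerivAt_iff_hasFDerivAt, ← hasFDerivWithinAt_univ, hasFDerivWithinAt_euclidean]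
  intro k
  have hs := Real.hasDerivAt_sin t
  have hc := Real.hasDerivAt_cos t
  have : HasDerivAt (fun t => planeRotation i j t x k)
      ((planeRotation i j t x i • EuclideanSpace.single j (1 : ℝ)
        - planeRotation i j t x j • EuclideanSpace.single i (1 : ℝ) : E n) k) t := by
    simp only [planeRotation_apply, PiLp.sub_apply, PiLp.smul_apply, PiLp.single_apply, smul_eq_mul,
      if_true, if_neg hij.symm]
    by_cases h1 : k = i
    · subst h1
      simp only [if_true, if_neg hij]
      exact ((hc.const_mul _).sub (hs.const_mul _)).congr_deriv (by ring)
    · by_cases h2 : k = j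
      · subst h2
        simp only [if_true, if_neg h1]
        exact ((hs.const_mul _).add (hc.const_mul _)).congr_deriv (by ring)
      · simp only [if_neg h1, if_neg h2]
        exact (hasDerivAt_const t _).congr_deriv (by ring)
  refine this.hasFDerivAt.hasFDerivWithinAt.congr_fderiv ?_
  ext
  simp

/-- The velocity of `planeRotation i j t` is `x_i e_j - x_j e_i`, that is `-D_{i,j}`; reversing time
produces `D_{i,j}` itself. -/
theorem hasDerivAt_comp_planeRotation_neg (hij : i ≠ j) {g : E n → ℝ} (hg : Differentiable ℝ g)
    (x : E n) (t : ℝ) :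
    HasDerivAt (fun t => g (planeRotation i j (-t) x)) (angDeriv i j g (planeRotation i j (-t) x))
      t := by
  have h1 := (hasDerivAt_planeRotation hij x (-t)).scomp t (hasDerivAt_neg t)
  refine ((hg _).hasFDerivAt.comp_hasDerivAt t h1).congr_deriv ?_
  rw [angDeriv, map_smul, map_sub, map_smul, map_smul]
  simp only [smul_eq_mul, Function.comp_apply]
  ring

/-- Rotations in the same plane commute, so both sides are the derivative at time zero of the same
curve. -/
theorem angDeriv_comp_planeRotation (hij : i ≠ j) {g : E n → ℝ} (hg : Differentiable ℝ g) (t : ℝ) :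
    angDeriv i j (fun x => g (planeRotation i j t x))
      = fun x => angDeriv i j g (planeRotation i j t x) := by
  ext x
  have hd : Differentiable ℝ fun x => g (planeRotation i j t x) :=
    hg.comp ((contDiff_planeRotation hij t).differentiable (by simp))
  have h1 := hasDerivAt_comp_planeRotation_neg hij hd x 0
  have h2 := hasDerivAt_comp_planeRotation_neg hij hg (planeRotation i j t x) 0
  simp only [neg_zero, planeRotation_zero] at h1 h2
  refine h1.unique ?_
  refine h2.congr_of_eventuallyEq (Filter.Eventually.of_forall fun s => ?_)
  simp only [← planeRotation_add hij, add_comm]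

theorem contDiff_angDeriv {g : E n → ℝ} (hg : ContDiff ℝ ∞ g) (i j : Fin n) :
    ContDiff ℝ ∞ (angDeriv i j g) := by
  have h1 : ContDiff ℝ ∞ (fderiv ℝ g) := hg.fderiv_right (by simp)
  have h2 : ∀ k : Fin n, ContDiff ℝ ∞ fun x : E n => x k := fun k =>
    (EuclideanSpace.proj k : E n →L[ℝ] ℝ).contDiff
  exact ((h2 j).mul (h1.clm_apply contDiff_const)).sub ((h2 i).mul (h1.clm_apply contDiff_const))

theorem angDiff_congr_ae {ν : Measure (E n)} (hQ : ∀ t, MeasurePreserving (planeRotation i j t) ν ν)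
    {f f' : E n → ℝ} (h : f =ᵐ[ν] f') (l : ℕ) (θ : ℝ) :
    angDiff l i j θ f =ᵐ[ν] angDiff l i j θ f' := by
  have : ∀ k ∈ Finset.range (l + 1), ∀ᵐ x ∂ν,
      f (planeRotation i j ((k : ℝ) * θ) x) = f' (planeRotation i j ((k : ℝ) * θ) x) := fun k _ =>
    (hQ _).quasiMeasurePreserving.ae h
  filter_upwards [(Finset.eventually_all _).2 this] with x hx
  exact Finset.sum_congr rfl fun k hk => by rw [hx k hk]

end planeRotation

/-! ### The rotation group on models of function spaces -/

/-- A compact set with a finite measure of full support on it, both invariant under all plane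
rotations. -/
structure RotationInvariant {n : ℕ} (K : Set (E n)) (ν : Measure (E n)) : Prop where
  isCompact : IsCompact K
  isFiniteMeasure : IsFiniteMeasure ν
  measure_compl : ν Kᶜ = 0
  planeRotation_mem : ∀ i j, i ≠ j → ∀ t, ∀ x ∈ K, planeRotation i j t x ∈ K
  measurePreserving : ∀ i j, i ≠ j → ∀ t, MeasurePreserving (planeRotation i j t) ν ν
  measure_pos : ∀ U, IsOpen U → (U ∩ K).Nonempty → ν U ≠ 0

theorem RotationInvariant.ae_mem {n : ℕ} {K : Set (E n)} {ν : Measure (E n)}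
    (H : RotationInvariant K ν) : ∀ᵐ x ∂ν, x ∈ K :=
  H.measure_compl

/-- A Banach space of functions representing `L^p(K, ν)`, or `C(K)` if `p = ∞`. -/
structure FunctionModel {n : ℕ} (p : ℝ≥0∞) (K : Set (E n)) (ν : Measure (E n)) (X : Type*)
    [NormedAddCommGroup X] [NormedSpace ℝ X] where
  toFun : X → E n → ℝ
  memSpace : ∀ x, MemSpace p K ν (toFun x)
  exists_ae_eq : ∀ f, MemSpace p K ν f → ∃ x, toFun x =ᵐ[ν] f
  toFun_add : ∀ x y, toFun (x + y) =ᵐ[ν] toFun x + toFun y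
  toFun_smul : ∀ (c : ℝ) x, toFun (c • x) =ᵐ[ν] c • toFun x
  enorm_eq : ∀ x, ‖x‖ₑ = eLpNorm (toFun x) p ν
  continuous_rotation : ∀ i j, i ≠ j → ∀ (x : X) (F : ℝ → X),
    (∀ t, toFun (F t) =ᵐ[ν] toFun x ∘ planeRotation i j t) → Continuous F

namespace FunctionModel

variable {n : ℕ} {p : ℝ≥0∞} {K : Set (E n)} {ν : Measure (E n)} {X : Type*}
  [NormedAddCommGroup X] [NormedSpace ℝ X] (M : FunctionModel p K ν X)

theorem toFun_sub (x y : X) : M.toFun (x - y) =ᵐ[ν] M.toFun x - M.toFun y := by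
  rw [sub_eq_add_neg, ← neg_one_smul ℝ y]
  filter_upwards [M.toFun_add x ((-1 : ℝ) • y), M.toFun_smul (-1) y] with z h1 h2
  rw [h1, Pi.add_apply, h2]
  simp [sub_eq_add_neg]

theorem toFun_zero : M.toFun 0 =ᵐ[ν] 0 := by
  have := M.toFun_smul 0 0
  rwa [zero_smul, zero_smul] at this

theorem ext_ae {x y : X} (h : M.toFun x =ᵐ[ν] M.toFun y) : x = y := by
  rw [← sub_eq_zero, ← enorm_eq_zero, M.enorm_eq]
  refine (eLpNorm_congr_ae (g := 0) ?_).trans eLpNorm_zero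
  filter_upwards [M.toFun_sub x y, h] with z h1 h2
  rw [h1, Pi.sub_apply, h2, sub_self, Pi.zero_apply]

theorem toFun_sum {ι : Type*} (s : Finset ι) (c : ι → ℝ) (x : ι → X) :
    M.toFun (∑ k ∈ s, c k • x k) =ᵐ[ν] fun z => ∑ k ∈ s, c k * M.toFun (x k) z := by
  classical
  induction s using Finset.induction_on with
  | empty =>
    simp only [Finset.sum_empty]
    exact M.toFun_zero
  | insert a s ha ih =>
    rw [Finset.sum_insert ha]
    filter_upwards [M.toFun_add (c a • x a) (∑ k ∈ s, c k • x k), M.toFun_smul (c a) (x a), ih]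
      with z h1 h2 h3
    rw [h1, Pi.add_apply, h2, h3, Finset.sum_insert ha]
    rfl

theorem memSpace_rotation (H : RotationInvariant K ν) {i j : Fin n} (hij : i ≠ j) {f : E n → ℝ}
    (hf : MemSpace p K ν f) (t : ℝ) : MemSpace p K ν (f ∘ planeRotation i j t) :=
  ⟨hf.1.comp_measurePreserving (H.measurePreserving i j hij t), fun hp =>
    (hf.2 hp).comp (continuous_planeRotation t).continuousOn (H.planeRotation_mem i j hij t)⟩

theorem integrable (H : RotationInvariant K ν) (hp : 1 ≤ p) (x : X) : Integrable (M.toFun x) ν :=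
  have := H.isFiniteMeasure
  (M.memSpace x).1.integrable hp

theorem exists_bound (H : RotationInvariant K ν) {g : E n → ℝ} (hg : Continuous g) :
    ∃ C : ℝ, 0 ≤ C ∧ ∀ x ∈ K, ‖g x‖ ≤ C := by
  obtain ⟨C, hC⟩ := H.isCompact.exists_bound_of_continuousOn hg.continuousOn
  exact ⟨max C 0, le_max_right _ _, fun x hx => (hC x hx).trans (le_max_left _ _)⟩

theorem integrable_mul (H : RotationInvariant K ν) (hp : 1 ≤ p) (x : X) {g : E n → ℝ}
    (hg : Continuous g) : Integrable (fun z => M.toFun x z * g z) ν := by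
  obtain ⟨C, -, hC⟩ := exists_bound H hg
  exact (M.integrable H hp x).mul_bdd hg.aestronglyMeasurable (H.ae_mem.mono hC)

/-- The action of the rotation on the model. -/
def rotate (H : RotationInvariant K ν) {i j : Fin n} (hij : i ≠ j) (t : ℝ) (x : X) : X :=
  (M.exists_ae_eq _ (memSpace_rotation H hij (M.memSpace x) t)).choose

theorem toFun_rotate (H : RotationInvariant K ν) {i j : Fin n} (hij : i ≠ j) (t : ℝ) (x : X) :
    M.toFun (M.rotate H hij t x) =ᵐ[ν] M.toFun x ∘ planeRotation i j t :=
  (M.exists_ae_eq _ (memSpace_rotation H hij (M.memSpace x) t)).choose_spec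

theorem enorm_rotate (H : RotationInvariant K ν) {i j : Fin n} (hij : i ≠ j) (t : ℝ) (x : X) :
    ‖M.rotate H hij t x‖ₑ = ‖x‖ₑ := by
  rw [M.enorm_eq, M.enorm_eq, eLpNorm_congr_ae (M.toFun_rotate H hij t x)]
  exact eLpNorm_comp_measurePreserving (M.memSpace x).1.1 (H.measurePreserving i j hij t)

theorem norm_rotate (H : RotationInvariant K ν) {i j : Fin n} (hij : i ≠ j) (t : ℝ) (x : X) :
    ‖M.rotate H hij t x‖ = ‖x‖ := by
  rw [← toReal_enorm, M.enorm_rotate, toReal_enorm]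

/-- Makes the test functionals bounded: `g` is bounded on the compact `K`, and `L^p` embeds in `L^1`
since `ν` is finite. -/
theorem exists_norm_integral_mul_le (H : RotationInvariant K ν) (hp : 1 ≤ p) {g : E n → ℝ}
    (hg : Continuous g) : ∃ C : ℝ, ∀ x, ‖∫ z, M.toFun x z * g z ∂ν‖ ≤ C * ‖x‖ := by
  have := H.isFiniteMeasure
  obtain ⟨C, hC0, hC⟩ := exists_bound H hg
  set B : ℝ≥0∞ := ν univ ^ (1 / (1 : ℝ≥0∞).toReal - 1 / p.toReal) with hB
  have hBt : B ≠ ⊤ := by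
    refine ENNReal.rpow_ne_top_of_nonneg ?_ (measure_ne_top _ _)
    rcases eq_or_ne p ⊤ with rfl | hpt
    · simp
    · have : 1 ≤ p.toReal := by
        rw [← ENNReal.toReal_one]; exact ENNReal.toReal_mono hpt hp
      simp only [ENNReal.toReal_one, div_one, sub_nonneg]
      rw [one_div]; exact inv_le_one_of_one_le₀ this
  refine ⟨C * B.toReal, fun x => ?_⟩
  have h1 : ∫ z, ‖M.toFun x z‖ ∂ν ≤ ‖x‖ * B.toReal := by
    rw [integral_norm_eq_lintegral_enorm (M.memSpace x).1.1, ← eLpNorm_one_eq_lintegral_enorm]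
    have := eLpNorm_le_eLpNorm_mul_rpow_measure_univ hp (M.memSpace x).1.1
    rw [← M.enorm_eq] at this
    have h2 := ENNReal.toReal_mono (ENNReal.mul_ne_top enorm_ne_top hBt) this
    rwa [ENNReal.toReal_mul, toReal_enorm] at h2
  have h2 : ‖∫ z, M.toFun x z * g z ∂ν‖ ≤ ∫ z, C * ‖M.toFun x z‖ ∂ν := by
    refine norm_integral_le_of_norm_le ((M.integrable H hp x).norm.const_mul C) ?_
    filter_upwards [H.ae_mem] with z hz
    rw [norm_mul, mul_comm]
    exact mul_le_mul_of_nonneg_right (hC z hz) (norm_nonneg _)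
  rw [integral_const_mul] at h2
  refine h2.trans ?_
  calc C * ∫ z, ‖M.toFun x z‖ ∂ν ≤ C * (‖x‖ * B.toReal) := by gcongr
    _ = _ := by ring

theorem integral_rotate_mul (H : RotationInvariant K ν) {i j : Fin n} (hij : i ≠ j) (t : ℝ) (x : X)
    (g : E n → ℝ) :
    ∫ z, M.toFun (M.rotate H hij t x) z * g z ∂ν
      = ∫ z, M.toFun x z * g (planeRotation i j (-t) z) ∂ν := by
  have e : MeasurableEmbedding (planeRotation (n := n) i j t) :=
    (planeRotationEquiv hij t).toHomeomorph.measurableEmbedding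
  rw [← (H.measurePreserving i j hij t).integral_comp e
    fun z => M.toFun x z * g (planeRotation i j (-t) z)]
  refine integral_congr_ae ?_
  filter_upwards [M.toFun_rotate H hij t x] with z hz
  simp only [planeRotation_neg_cancel hij, hz, Function.comp_apply]

/-- Once the rotation sits on `g`, the derivative falls on the test function alone; `angDeriv i j g`
is bounded on the invariant set `K`, which gives the dominating function. -/
theorem hasDerivAt_integral (H : RotationInvariant K ν) (hp : 1 ≤ p) {i j : Fin n} (hij : i ≠ j)
    (x : X) {g : E n → ℝ} (hg : ContDiff ℝ ∞ g) (t : ℝ) :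
    HasDerivAt (fun t => ∫ z, M.toFun x z * g (planeRotation i j (-t) z) ∂ν)
      (∫ z, M.toFun x z * angDeriv i j g (planeRotation i j (-t) z) ∂ν) t := by
  obtain ⟨C, hC0, hC⟩ := exists_bound H (contDiff_angDeriv hg i j).continuous
  refine (hasDerivAt_integral_of_dominated_loc_of_deriv_le
    (F := fun t z => M.toFun x z * g (planeRotation i j (-t) z))
    (F' := fun t z => M.toFun x z * angDeriv i j g (planeRotation i j (-t) z))
    (bound := fun z => ‖M.toFun x z‖ * C) Filter.univ_mem ?_ ?_ ?_ ?_ ?_ ?_).2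
  · exact Filter.Eventually.of_forall fun s => (M.integrable_mul H hp x
      (hg.continuous.comp (continuous_planeRotation _))).aestronglyMeasurable
  · exact M.integrable_mul H hp x (hg.continuous.comp (continuous_planeRotation _))
  · exact (M.integrable_mul H hp x ((contDiff_angDeriv hg i j).continuous.comp
      (continuous_planeRotation _))).aestronglyMeasurable
  · filter_upwards [H.ae_mem] with z hz s _
    rw [norm_mul]
    exact mul_le_mul_of_nonneg_left (hC _ (H.planeRotation_mem i j hij _ z hz)) (norm_nonneg _)
  · exact (M.integrable H hp x).norm.mul_const C
  · exact Filter.Eventually.of_forall fun z s _ =>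
      (hasDerivAt_comp_planeRotation_neg hij (hg.differentiable (by simp)) z s).const_mul _

/-- The rotation group acting on the model, with the smooth functions as test functions. -/
def flow (H : RotationInvariant K ν) (hp : 1 ≤ p) {i j : Fin n} (hij : i ≠ j) :
    FlowSystem X {g : E n → ℝ // ContDiff ℝ ∞ g} where
  T t := LinearMap.mkContinuous
    { toFun := M.rotate H hij t
      map_add' := fun x y => M.ext_ae <| by
        have hq := (H.measurePreserving i j hij t).quasiMeasurePreserving.ae (M.toFun_add x y)
        filter_upwards [M.toFun_rotate H hij t (x + y), M.toFun_rotate H hij t x,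
          M.toFun_rotate H hij t y, M.toFun_add (M.rotate H hij t x) (M.rotate H hij t y), hq]
          with z h1 h2 h3 h4 h5
        rw [h1, h4, Pi.add_apply, h2, h3]
        exact h5
      map_smul' := fun c x => M.ext_ae <| by
        have hq := (H.measurePreserving i j hij t).quasiMeasurePreserving.ae (M.toFun_smul c x)
        filter_upwards [M.toFun_rotate H hij t (c • x), M.toFun_rotate H hij t x,
          M.toFun_smul c (M.rotate H hij t x), hq] with z h1 h2 h3 h4
        rw [h1, RingHom.id_apply, h3, Pi.smul_apply, h2]
        exact h4 } 1 fun x => by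
      rw [one_mul]; exact (M.norm_rotate H hij t x).le
  T_zero := by
    ext x
    refine M.ext_ae ((M.toFun_rotate H hij 0 x).trans (Filter.EventuallyEq.of_eq ?_))
    ext z
    exact congrArg (M.toFun x) (planeRotation_zero z)
  T_add s t x := by
    refine M.ext_ae ((M.toFun_rotate H hij (s + t) x).trans ?_)
    have hq := (H.measurePreserving i j hij s).quasiMeasurePreserving.ae
      (M.toFun_rotate H hij t x)
    refine Filter.EventuallyEq.symm ((M.toFun_rotate H hij s _).trans ?_)
    filter_upwards [hq] with z hz
    refine hz.trans ?_
    rw [Function.comp_apply, Function.comp_apply, ← planeRotation_add hij, add_comm]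
  norm_T := M.norm_rotate H hij
  continuous_T x := M.continuous_rotation i j hij x _ fun t => M.toFun_rotate H hij t x
  pair g := LinearMap.mkContinuous
    { toFun := fun x => ∫ z, M.toFun x z * g.1 z ∂ν
      map_add' := fun x y => by
        rw [← integral_add (M.integrable_mul H hp x g.2.continuous)
          (M.integrable_mul H hp y g.2.continuous)]
        refine integral_congr_ae ?_
        filter_upwards [M.toFun_add x y] with z hz
        rw [hz, Pi.add_apply, add_mul]
      map_smul' := fun c x => by
        rw [RingHom.id_apply, smul_eq_mul, ← integral_const_mul]
        refine integral_congr_ae ?_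
        filter_upwards [M.toFun_smul c x] with z hz
        rw [hz, Pi.smul_apply, smul_eq_mul, mul_assoc] }
    (M.exists_norm_integral_mul_le H hp g.2.continuous).choose
    (M.exists_norm_integral_mul_le H hp g.2.continuous).choose_spec
  D g := ⟨angDeriv i j g.1, contDiff_angDeriv g.2 i j⟩
  trans t g := ⟨fun z => g.1 (planeRotation i j (-t) z), g.2.comp (contDiff_planeRotation hij _)⟩
  pair_T t g x := M.integral_rotate_mul H hij t x g.1
  D_trans t g := Subtype.ext <|
    angDeriv_comp_planeRotation hij (g.2.differentiable (by simp)) (-t)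
  hasDerivAt_pair g x t := by
    have h : ∀ (g : E n → ℝ) t, ∫ z, M.toFun (M.rotate H hij t x) z * g z ∂ν
      = ∫ z, M.toFun x z * g (planeRotation i j (-t) z) ∂ν := fun g t =>
      M.integral_rotate_mul H hij t x g
    change HasDerivAt (fun t => ∫ z, M.toFun (M.rotate H hij t x) z * g.1 z ∂ν)
      (∫ z, M.toFun (M.rotate H hij t x) z * angDeriv i j g.1 z ∂ν) t
    simp only [h]
    exact M.hasDerivAt_integral H hp hij x g.2 t
  eq_zero x hx := by
    refine M.ext_ae (Filter.EventuallyEq.trans ?_ M.toFun_zero.symm)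
    -- Compactly supported smooth functions are among the test functions and already separate
    -- integrable ones.
    refine ae_eq_zero_of_integral_contDiff_smul_eq_zero
      (M.integrable H hp x).locallyIntegrable fun g hg _ => ?_
    refine Eq.trans ?_ (hx ⟨g, hg⟩)
    exact integral_congr_ae (Filter.Eventually.of_forall fun z => mul_comm _ _)

variable (H : RotationInvariant K ν) (hp : 1 ≤ p) {i j : Fin n} (hij : i ≠ j)

theorem flow_D_iterate (r : ℕ) (g : {g : E n → ℝ // ContDiff ℝ ∞ g}) :
    ((M.flow H hp hij).D^[r] g).1 = (angDeriv i j)^[r] g.1 := by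
  induction r with
  | zero => rfl
  | succ r ih => rw [Function.iterate_succ_apply', Function.iterate_succ_apply', ← ih]; rfl

theorem weakDeriv_iff (r : ℕ) {x y : X} {f h : E n → ℝ} (hx : M.toFun x =ᵐ[ν] f)
    (hy : M.toFun y =ᵐ[ν] h) :
    (M.flow H hp hij).WeakDeriv r x y ↔ IsWeakAngDeriv r i j ν f h := by
  have e1 : ∀ g : E n → ℝ, ∫ z, h z * g z ∂ν = ∫ z, M.toFun y z * g z ∂ν := fun g =>
    integral_congr_ae (hy.mono fun z hz => by simp only [hz])
  have e2 : ∀ g : E n → ℝ, ∫ z, f z * g z ∂ν = ∫ z, M.toFun x z * g z ∂ν := fun g =>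
    integral_congr_ae (hx.mono fun z hz => by simp only [hz])
  have e3 : ∀ g : {g : E n → ℝ // ContDiff ℝ ∞ g}, ∀ x, (M.flow H hp hij).pair
      ((M.flow H hp hij).D^[r] g) x = ∫ z, M.toFun x z * (angDeriv i j)^[r] g.1 z ∂ν :=
    fun g x => by rw [← M.flow_D_iterate H hp hij]; rfl
  constructor
  · intro hw g hg
    have := hw ⟨g, hg⟩
    rw [e3] at this
    rw [e1, e2]
    exact this
  · intro hw g
    have := hw g.1 g.2
    rw [e1, e2] at this
    rw [e3]
    exact this

theorem toFun_diff_pow (l : ℕ) (θ : ℝ) {x : X} {f : E n → ℝ} (hx : M.toFun x =ᵐ[ν] f) :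
    M.toFun (((M.flow H hp hij).diff θ ^ l) x) =ᵐ[ν] angDiff l i j θ f := by
  have hQ := H.measurePreserving i j hij
  refine Filter.EventuallyEq.trans ?_ (angDiff_congr_ae hQ hx l θ)
  rw [FlowSystem.diff_pow_eq_sum]
  have : ∀ k ∈ Finset.range (l + 1), ∀ᵐ z ∂ν, M.toFun (M.rotate H hij ((k : ℝ) * θ) x) z
      = M.toFun x (planeRotation i j ((k : ℝ) * θ) z) := fun k _ => M.toFun_rotate H hij _ x
  filter_upwards [M.toFun_sum (Finset.range (l + 1))
    (fun k => (-1 : ℝ) ^ k * (l.choose k : ℝ)) fun k => M.rotate H hij ((k : ℝ) * θ) x,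
    (Finset.eventually_all _).2 this] with z h1 h2
  refine h1.trans (Finset.sum_congr rfl fun k hk => ?_)
  rw [h2 k hk]

theorem enorm_diff_pow (l : ℕ) (θ : ℝ) {x : X} {f : E n → ℝ} (hx : M.toFun x =ᵐ[ν] f) :
    ‖((M.flow H hp hij).diff θ ^ l) x‖ₑ = eLpNorm (angDiff l i j θ f) p ν := by
  rw [M.enorm_eq, eLpNorm_congr_ae (M.toFun_diff_pow H hp hij l θ hx)]

end FunctionModel

/-! ### Estimates for functions and the models `L^p` and `C(K)` -/

section

namespace FunctionModel

variable {n : ℕ} {p : ℝ≥0∞} {K : Set (E n)} {ν : Measure (E n)} {X : Type*}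
  [NormedAddCommGroup X] [NormedSpace ℝ X] [CompleteSpace X]

theorem eLpNorm_angDiff_add_le (M : FunctionModel p K ν X) (H : RotationInvariant K ν)
    (hp : 1 ≤ p) {i j : Fin n} (hij : i ≠ j) {r : ℕ} (l : ℕ) (θ : ℝ) {f h : E n → ℝ}
    (hf : MemSpace p K ν f) (hh : MemSpace p K ν h) (hw : IsWeakAngDeriv r i j ν f h) :
    eLpNorm (angDiff (r + l) i j θ f) p ν
      ≤ ENNReal.ofReal (|θ| ^ r) * eLpNorm (angDiff l i j θ h) p ν := by
  obtain ⟨x, hx⟩ := M.exists_ae_eq f hf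
  obtain ⟨y, hy⟩ := M.exists_ae_eq h hh
  rw [← M.enorm_diff_pow H hp hij (r + l) θ hx, ← M.enorm_diff_pow H hp hij l θ hy,
    ← ofReal_norm, ← ofReal_norm, ← ENNReal.ofReal_mul (by positivity)]
  exact ENNReal.ofReal_le_ofReal
    (((M.weakDeriv_iff H hp hij r hx hy).2 hw).norm_diff_pow_add_le l θ)

theorem exists_lipSeminorm_le (M : FunctionModel p K ν X) (H : RotationInvariant K ν)
    (hp : 1 ≤ p) (r l : ℕ) (hl : 1 ≤ l) {α : ℝ} (hα0 : 0 < α) (hα1 : α < 1) :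
    ∃ C : ℝ, 0 ≤ C ∧ ∀ i j, i ≠ j → ∀ f, MemSpace p K ν f → ∀ A : ℝ≥0∞, A ≠ ⊤ →
      (∀ θ : ℝ, |θ| ≤ 1 → eLpNorm (angDiff (r + l) i j θ f) p ν
        ≤ A * ENNReal.ofReal (|θ| ^ ((r : ℝ) + α))) →
      lipSeminorm p r l α K ν i j f ≤ ENNReal.ofReal C * (A + eLpNorm f p ν) := by
  obtain ⟨C, hC0, hC⟩ := FlowSystem.exists_weakDeriv_of_diff_le X {g : E n → ℝ // ContDiff ℝ ∞ g}
    r l hl hα0 hα1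
  refine ⟨C, hC0, fun i j hij f hf A hA hfA => ?_⟩
  obtain ⟨x, hx⟩ := M.exists_ae_eq f hf
  obtain ⟨y, hy, hyb⟩ := hC (M.flow H hp hij) x A.toReal ENNReal.toReal_nonneg fun t ht => by
    have h1 := hfA t ht
    rw [← M.enorm_diff_pow H hp hij (r + l) t hx] at h1
    have h2 := ENNReal.toReal_mono (ENNReal.mul_ne_top hA ENNReal.ofReal_ne_top) h1
    rwa [toReal_enorm, ENNReal.toReal_mul,
      ENNReal.toReal_ofReal (Real.rpow_nonneg (abs_nonneg _) _)] at h2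
  -- Any one weak derivative in the space bounds the infimum, so the `y` constructed by the converse
  -- estimate suffices.
  refine iInf₂_le_of_le (M.toFun y)
    ⟨M.memSpace y, (M.weakDeriv_iff H hp hij r hx (Filter.EventuallyEq.refl _ _)).1 hy⟩ ?_
  refine iSup₂_le fun θ hθ => ENNReal.div_le_of_le_mul ?_
  rw [← M.enorm_diff_pow H hp hij l θ (Filter.EventuallyEq.refl _ _), ← ofReal_norm,
    ← eLpNorm_congr_ae hx, ← M.enorm_eq, ← ofReal_norm, ← ENNReal.ofReal_toReal hA,
    ← ENNReal.ofReal_add ENNReal.toReal_nonneg (norm_nonneg _), ← ENNReal.ofReal_mul hC0,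
    ← ENNReal.ofReal_mul (by positivity)]
  exact ENNReal.ofReal_le_ofReal (hyb θ hθ.1 hθ.2)

end FunctionModel

variable {n : ℕ} {K : Set (E n)} {ν : Measure (E n)}

/-- The model `Lp` for `p < ∞`. -/
def lpModel (H : RotationInvariant K ν) {p : ℝ≥0∞} [Fact (1 ≤ p)] (hp : p ≠ ⊤) :
    FunctionModel p K ν (Lp ℝ p ν) where
  toFun x := x
  memSpace x := ⟨Lp.memLp x, fun h => absurd h hp⟩
  exists_ae_eq f hf := ⟨hf.1.toLp f, hf.1.coeFn_toLp⟩
  toFun_add := Lp.coeFn_add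
  toFun_smul := Lp.coeFn_smul
  enorm_eq := Lp.enorm_def
  continuous_rotation i j hij x F hF := by
    have := H.isFiniteMeasure
    let Q : ℝ → C(E n, E n) := fun t => ⟨planeRotation i j t, continuous_planeRotation t⟩
    have hQ : Continuous Q :=
      ContinuousMap.continuous_of_continuous_uncurry _ continuous_planeRotation_uncurry
    have e : F = fun t => Lp.compMeasurePreserving (Q t) (H.measurePreserving i j hij t) x := by
      ext1 t
      exact Lp.ext ((hF t).trans
        (Lp.coeFn_compMeasurePreserving x (H.measurePreserving i j hij t)).symm)
    rw [e]
    -- Strong continuity of the rotations is where `p < ∞` enters; for `p = ∞` it comes from uniform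
    -- continuity on `K` instead.
    exact continuous_const.compMeasurePreservingLp hQ _ hp

/-- The extension by zero of a function on `K`. -/
def extendZero (x : K → ℝ) (z : E n) : ℝ :=
  open Classical in if h : z ∈ K then x ⟨z, h⟩ else 0

theorem extendZero_of_mem (x : K → ℝ) {z : E n} (h : z ∈ K) : extendZero x z = x ⟨z, h⟩ := by
  rw [extendZero, dif_pos h]

theorem continuousOn_extendZero (x : C(K, ℝ)) : ContinuousOn (extendZero x) K := by
  rw [continuousOn_iff_continuous_domRestrict]
  convert x.continuous using 1
  ext z
  exact extendZero_of_mem x z.2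

theorem RotationInvariant.aestronglyMeasurable (H : RotationInvariant K ν) {f : E n → ℝ}
    (hf : ContinuousOn f K) : AEStronglyMeasurable f ν := by
  have := hf.aestronglyMeasurable (μ := ν) H.isCompact.isClosed.measurableSet
  rwa [Measure.restrict_eq_self_of_ae_mem H.ae_mem] at this

/-- If the value at `z` exceeded the essential supremum, so would the values on a relatively open
subset of `K`, which has positive measure. -/
theorem RotationInvariant.norm_le_eLpNorm_top (H : RotationInvariant K ν) {f : E n → ℝ}
    (hf : ContinuousOn f K) {z : E n} (hz : z ∈ K) : ‖f z‖ₑ ≤ eLpNorm f ⊤ ν := by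
  by_contra! hlt
  obtain ⟨U, hU, hUK⟩ := (continuousOn_iff'.1 hf.enorm) _
    (isOpen_Ioi (a := eLpNorm f ⊤ ν))
  refine H.measure_pos U hU ⟨z, hUK ▸ ⟨hlt, hz⟩⟩ ?_
  have h1 : ∀ᵐ w ∂ν, w ∉ U := by
    have h2 : ∀ᵐ w ∂ν, ‖f w‖ₑ ≤ eLpNormEssSup f ν := ae_le_eLpNormEssSup
    filter_upwards [h2, H.ae_mem] with w hw hwK hwU
    have : w ∈ (fun y => ‖f y‖ₑ) ⁻¹' Ioi (eLpNorm f ⊤ ν) ∩ K := by rw [hUK]; exact ⟨hwU, hwK⟩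
    rw [← eLpNorm_exponent_top] at hw
    exact not_lt.2 hw this.1
  simpa [ae_iff] using h1

/-- The model `C(K)` for `p = ∞`. -/
def continuousModel (H : RotationInvariant K ν) [CompactSpace K] :
    FunctionModel ⊤ K ν C(K, ℝ) where
  toFun x := extendZero x
  memSpace x := by
    have := H.isFiniteMeasure
    refine ⟨MemLp.of_bound (H.aestronglyMeasurable (continuousOn_extendZero x)) ‖x‖ ?_,
      fun _ => continuousOn_extendZero x⟩
    filter_upwards [H.ae_mem] with z hz
    rw [extendZero_of_mem _ hz]
    exact x.norm_coe_le_norm _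
  exists_ae_eq f hf := by
    refine ⟨⟨K.domRestrict f, continuousOn_iff_continuous_domRestrict.1 (hf.2 rfl)⟩, ?_⟩
    filter_upwards [H.ae_mem] with z hz
    exact extendZero_of_mem _ hz
  toFun_add x y := by
    filter_upwards [H.ae_mem] with z hz
    simp only [Pi.add_apply, extendZero_of_mem _ hz, ContinuousMap.add_apply]
  toFun_smul c x := by
    filter_upwards [H.ae_mem] with z hz
    simp only [Pi.smul_apply, extendZero_of_mem _ hz, ContinuousMap.smul_apply]
  enorm_eq x := by
    refine le_antisymm ?_ ?_
    · by_cases ht : eLpNorm (extendZero x) ⊤ ν = ⊤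
      · rw [ht]; exact le_top
      · rw [← ofReal_norm, ← ENNReal.ofReal_toReal ht]
        refine ENNReal.ofReal_le_ofReal ((x.norm_le ENNReal.toReal_nonneg).2 fun z => ?_)
        have := H.norm_le_eLpNorm_top (continuousOn_extendZero x) z.2
        rw [extendZero_of_mem _ z.2] at this
        rw [← toReal_enorm]
        exact ENNReal.toReal_mono ht this
    · rw [eLpNorm_exponent_top]
      refine essSup_le_of_ae_le _ ?_
      filter_upwards [H.ae_mem] with z hz
      rw [extendZero_of_mem _ hz, ← ofReal_norm, ← ofReal_norm]
      exact ENNReal.ofReal_le_ofReal (x.norm_coe_le_norm _)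
  continuous_rotation i j hij x F hF := by
    let Q : ℝ → C(K, K) := fun t => ⟨fun z => ⟨planeRotation i j t z,
      H.planeRotation_mem i j hij t z z.2⟩,
      ((continuous_planeRotation t).comp continuous_subtype_val).subtype_mk _⟩
    have hQ : Continuous Q := ContinuousMap.continuous_of_continuous_uncurry _
      ((continuous_planeRotation_uncurry.comp
        (continuous_fst.prodMk (continuous_subtype_val.comp continuous_snd))).subtype_mk _)
    have e : F = fun t => x.comp (Q t) := by
      ext t z
      -- The hypothesis on `F` holds only almost everywhere; continuity and full support upgrade it
      -- to every point of `K`.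
      have hc : ContinuousOn (fun w => extendZero (F t) w - extendZero (x.comp (Q t)) w) K :=
        (continuousOn_extendZero _).sub (continuousOn_extendZero _)
      have h0 : eLpNorm (fun w => extendZero (F t) w - extendZero (x.comp (Q t)) w) ⊤ ν = 0 := by
        refine (eLpNorm_congr_ae (g := 0) ?_).trans eLpNorm_zero
        filter_upwards [hF t, H.ae_mem] with w hw hwK
        rw [hw, Function.comp_apply, extendZero_of_mem _ hwK,
          extendZero_of_mem _ (H.planeRotation_mem i j hij t w hwK)]
        exact sub_self _
      have h1 := H.norm_le_eLpNorm_top hc z.2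
      rw [h0, le_zero_iff, enorm_eq_zero, extendZero_of_mem _ z.2, extendZero_of_mem _ z.2,
        sub_eq_zero] at h1
      exact h1
    rw [e]
    exact continuous_const.compCM hQ

theorem RotationInvariant.eLpNorm_angDiff_add_le (H : RotationInvariant K ν) {p : ℝ≥0∞}
    (hp : 1 ≤ p) {i j : Fin n} (hij : i ≠ j) {r : ℕ} (l : ℕ) (θ : ℝ) {f h : E n → ℝ}
    (hf : MemSpace p K ν f) (hh : MemSpace p K ν h) (hw : IsWeakAngDeriv r i j ν f h) :
    eLpNorm (angDiff (r + l) i j θ f) p ν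
      ≤ ENNReal.ofReal (|θ| ^ r) * eLpNorm (angDiff l i j θ h) p ν := by
  rcases eq_or_ne p ⊤ with rfl | hpt
  · have := isCompact_iff_compactSpace.1 H.isCompact
    exact (continuousModel H).eLpNorm_angDiff_add_le H hp hij l θ hf hh hw
  · have := Fact.mk hp
    exact (lpModel H hpt).eLpNorm_angDiff_add_le H hp hij l θ hf hh hw

theorem RotationInvariant.exists_lipSeminorm_le (H : RotationInvariant K ν) {p : ℝ≥0∞}
    (hp : 1 ≤ p) (r l : ℕ) (hl : 1 ≤ l) {α : ℝ} (hα0 : 0 < α) (hα1 : α < 1) :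
    ∃ C : ℝ, 0 ≤ C ∧ ∀ i j, i ≠ j → ∀ f, MemSpace p K ν f → ∀ A : ℝ≥0∞, A ≠ ⊤ →
      (∀ θ : ℝ, |θ| ≤ 1 → eLpNorm (angDiff (r + l) i j θ f) p ν
        ≤ A * ENNReal.ofReal (|θ| ^ ((r : ℝ) + α))) →
      lipSeminorm p r l α K ν i j f ≤ ENNReal.ofReal C * (A + eLpNorm f p ν) := by
  rcases eq_or_ne p ⊤ with rfl | hpt
  · have := isCompact_iff_compactSpace.1 H.isCompact
    exact (continuousModel H).exists_lipSeminorm_le H hp r l hl hα0 hα1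
  · have := Fact.mk hp
    exact (lpModel H hpt).exists_lipSeminorm_le H hp r l hl hα0 hα1

theorem angDiff_zero_angle {r : ℕ} (hr : 1 ≤ r) (i j : Fin n) (f : E n → ℝ) :
    angDiff r i j 0 f = 0 := by
  ext x
  simp only [angDiff, mul_zero, planeRotation_zero, Pi.zero_apply]
  rw [← Finset.sum_mul]
  have := Int.alternating_sum_range_choose_of_ne (n := r) (by omega)
  have h : ∑ k ∈ Finset.range (r + 1), (-1 : ℝ) ^ k * (r.choose k : ℝ) = 0 := by exact_mod_cast this
  rw [h, zero_mul]

/-- One-sided estimate: the differences of order `r + l` are bounded by the Lipschitz seminorm. -/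
theorem RotationInvariant.eLpNorm_angDiff_le_lipSeminorm (H : RotationInvariant K ν) {p : ℝ≥0∞}
    (hp : 1 ≤ p) {i j : Fin n} (hij : i ≠ j) {r : ℕ} (hr : 1 ≤ r) (l : ℕ) {α θ : ℝ} (hθ : |θ| ≤ 1)
    {f : E n → ℝ} (hf : MemSpace p K ν f) :
    eLpNorm (angDiff (r + l) i j θ f) p ν
      ≤ ENNReal.ofReal (|θ| ^ ((r : ℝ) + α)) * lipSeminorm p r l α K ν i j f := by
  rcases eq_or_ne θ 0 with rfl | hθ0
  · rw [angDiff_zero_angle (by omega)]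
    simp
  have hθp := abs_pos.2 hθ0
  have hne : ENNReal.ofReal (|θ| ^ ((r : ℝ) + α)) ≠ 0 := by
    rw [Ne, ENNReal.ofReal_eq_zero, not_le]
    positivity
  -- A positive finite factor passes through the infimum, so it is enough to treat each candidate
  -- derivative. If there is none, the infimum is `⊤`.
  simp only [lipSeminorm, iInf_subtype']
  rw [ENNReal.mul_iInf_of_ne hne ENNReal.ofReal_ne_top]
  refine le_iInf fun h => ?_
  refine (H.eLpNorm_angDiff_add_le hp hij l θ hf h.2.1 h.2.2).trans ?_
  have hθα : ENNReal.ofReal (|θ| ^ α) ≠ 0 := by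
    rw [Ne, ENNReal.ofReal_eq_zero, not_le]
    positivity
  have e : |θ| ^ ((r : ℝ) + α) = |θ| ^ r * |θ| ^ α := by
    rw [Real.rpow_add hθp, Real.rpow_natCast]
  rw [e, ENNReal.ofReal_mul (by positivity), mul_assoc]
  gcongr
  rw [mul_comm, ← ENNReal.div_le_iff_le_mul (Or.inl hθα) (Or.inl ENNReal.ofReal_ne_top)]
  exact le_iSup₂_of_le θ ⟨hθp, hθ⟩ le_rfl

end

/-! ### Invariant measures on the ball and the sphere -/

/-- In polar coordinates only the radius matters, and `1 - y² ≥ 1 - y` reduces the worst exponent to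
the integrability of `(1 - y)^(-1/2)`. -/
theorem integrableOn_one_sub_norm_sq_rpow {F : Type*} [NormedAddCommGroup F] [NormedSpace ℝ F]
    [FiniteDimensional ℝ F] [MeasurableSpace F] [BorelSpace F] [Nontrivial F] (ν : Measure F)
    [ν.IsAddHaarMeasure] {e : ℝ} (he : -1 / 2 ≤ e) :
    IntegrableOn (fun x : F => (1 - ‖x‖ ^ 2) ^ e) (Metric.ball 0 1) ν := by
  rw [integrableOn_fun_norm_addHaar ν (f := fun y => (1 - y ^ 2) ^ e)]
  have h1 : IntegrableOn (fun y : ℝ => (1 - y) ^ (-1 / 2 : ℝ)) (Ioo 0 1) := by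
    have h := ((intervalIntegral.intervalIntegrable_rpow' (a := 0) (b := 1)
      (by norm_num : (-1 : ℝ) < -1 / 2)).comp_sub_left 1).symm
    simp only [sub_zero, sub_self] at h
    rw [intervalIntegrable_iff_integrableOn_Ioo_of_le zero_le_one] at h
    exact h
  refine h1.mono' ?_ ?_
  · exact Measurable.aestronglyMeasurable (by fun_prop)
  · filter_upwards [ae_restrict_mem measurableSet_Ioo] with y hy
    have hy0 : 0 < 1 - y := sub_pos.2 hy.2
    have hy1 : 1 - y ≤ 1 - y ^ 2 := by nlinarith [hy.1, hy.2]
    have hy2 : 1 - y ^ 2 ≤ 1 := by nlinarith [sq_nonneg y]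
    have hy3 : 0 < 1 - y ^ 2 := hy0.trans_le hy1
    rw [norm_smul, Real.norm_of_nonneg (Real.rpow_nonneg hy3.le _),
      Real.norm_of_nonneg (pow_nonneg hy.1.le _)]
    calc y ^ (Module.finrank ℝ F - 1) * (1 - y ^ 2) ^ e ≤ 1 * (1 - y ^ 2) ^ (-1 / 2 : ℝ) := by
          exact mul_le_mul (pow_le_one₀ hy.1.le hy.2.le)
            (Real.rpow_le_rpow_of_exponent_ge hy3 hy2 he) (Real.rpow_nonneg hy3.le _) zero_le_one
      _ ≤ (1 - y) ^ (-1 / 2 : ℝ) := by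
          rw [one_mul]
          exact Real.rpow_le_rpow_of_nonpos hy0 hy1 (by norm_num)

/-- The density of `ballMeasure n μ`, supported on the open ball. -/
def ballDensity (n : ℕ) (μ : ℝ) : E n → ℝ≥0∞ :=
  (Metric.ball (0 : E n) 1).indicator fun x => ENNReal.ofReal ((1 - ‖x‖ ^ 2) ^ (μ - 1 / 2))

theorem measurable_ballDensity (n : ℕ) (μ : ℝ) : Measurable (ballDensity n μ) :=
  Measurable.indicator (by fun_prop) Metric.isOpen_ball.measurableSet

/-- The boundary sphere is null, so the value of the real power at `0` is irrelevant. For `n = 0`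
the open and closed balls coincide. -/
theorem ballMeasure_eq (n : ℕ) (μ : ℝ) :
    ballMeasure n μ = volume.withDensity (ballDensity n μ) := by
  rw [ballDensity, withDensity_indicator Metric.isOpen_ball.measurableSet, ballMeasure]
  congr 1
  refine Measure.restrict_congr_set (Filter.EventuallyEq.symm ?_)
  refine ae_eq_of_subset_of_measure_ge Metric.ball_subset_closedBall ?_
    Metric.isOpen_ball.measurableSet.nullMeasurableSet measure_closedBall_lt_top.ne
  rcases n with _ | n
  · refine measure_mono fun x _ => ?_
    rw [Subsingleton.elim x 0]
    simp
  · exact (Measure.addHaar_closedBall_eq_addHaar_ball _ _ _).le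

theorem ballDensity_ne_zero {n : ℕ} (μ : ℝ) {x : E n} (hx : x ∈ Metric.ball (0 : E n) 1) :
    ballDensity n μ x ≠ 0 := by
  rw [ballDensity, indicator_of_mem hx, Ne, ENNReal.ofReal_eq_zero, not_le]
  have : ‖x‖ < 1 := by simpa using hx
  have : 0 < 1 - ‖x‖ ^ 2 := by nlinarith [norm_nonneg x]
  positivity

theorem ballMeasure_rotationInvariant {n : ℕ} (hn : 1 ≤ n) {μ : ℝ} (hμ : 0 ≤ μ) :
    RotationInvariant (Metric.closedBall (0 : E n) 1) (ballMeasure n μ) where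
  isCompact := isCompact_closedBall _ _
  isFiniteMeasure := by
    have : Nonempty (Fin n) := ⟨⟨0, hn⟩⟩
    rw [ballMeasure_eq, ballDensity, withDensity_indicator Metric.isOpen_ball.measurableSet]
    exact isFiniteMeasure_withDensity_ofReal
      (integrableOn_one_sub_norm_sq_rpow volume (by linarith)).2
  measure_compl := by
    rw [ballMeasure]
    refine withDensity_absolutelyContinuous _ _ ?_
    rw [Measure.restrict_apply Metric.isClosed_closedBall.measurableSet.compl, compl_inter_self,
      measure_empty]
  planeRotation_mem i j hij t x hx := by
    simpa [norm_planeRotation hij] using hx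
  measurePreserving i j hij t := by
    have hQ : MeasurePreserving (planeRotation (n := n) i j t) volume volume :=
      (planeRotationEquiv hij t).measurePreserving
    rw [ballMeasure_eq]
    refine ⟨hQ.measurable, ?_⟩
    ext s hs
    rw [Measure.map_apply hQ.measurable hs, withDensity_apply _ (hQ.measurable hs),
      withDensity_apply _ hs, ← hQ.setLIntegral_comp_preimage hs (measurable_ballDensity n μ)]
    refine lintegral_congr fun x => ?_
    by_cases h : ‖x‖ < 1
    · rw [ballDensity, indicator_of_mem (by simpa using h),
        indicator_of_mem (by simpa [norm_planeRotation hij] using h), norm_planeRotation hij]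
    · rw [ballDensity, indicator_of_notMem (by simpa using h),
        indicator_of_notMem (by simpa [norm_planeRotation hij] using h)]
  measure_pos U hU hUK := by
    rw [ballMeasure_eq]
    intro h0
    rw [withDensity_apply_eq_zero (measurable_ballDensity n μ)] at h0
    obtain ⟨x, hxU, hxK⟩ := hUK
    rw [← closure_ball (0 : E n) one_ne_zero] at hxK
    obtain ⟨y, hy⟩ := mem_closure_iff.1 hxK U hU hxU
    refine (hU.inter Metric.isOpen_ball).measure_ne_zero volume ⟨y, hy⟩
      (measure_mono_null ?_ h0)
    exact fun z hz => ⟨ballDensity_ne_zero μ hz.2, hz.1⟩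

open scoped Pointwise in
-- Surface measure is read off from the volume of the cone over the set, so that rotation invariance
-- and projection can be treated with Lebesgue measure.
theorem sphereMeasure_apply {n : ℕ} {A : Set (E n)} (hA : MeasurableSet A) :
    sphereMeasure n A = n * volume (Ioo (0 : ℝ) 1 • (A ∩ Metric.sphere 0 1)) := by
  rw [sphereMeasure, Measure.map_apply measurable_subtype_coe hA,
    Measure.toSphere_apply' _ (measurable_subtype_coe hA), finrank_euclideanSpace_fin,
    Subtype.image_preimage_coe, inter_comm]

open scoped Pointwise in
theorem sphereMeasure_rotationInvariant (n : ℕ) :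
    RotationInvariant (Metric.sphere (0 : E n) 1) (sphereMeasure n) where
  isCompact := isCompact_sphere _ _
  isFiniteMeasure := Measure.isFiniteMeasure_map _ _
  measure_compl := by
    rw [sphereMeasure_apply Metric.isClosed_sphere.measurableSet.compl]
    simp
  planeRotation_mem i j hij t x hx := by
    simpa [norm_planeRotation hij] using hx
  measurePreserving i j hij t := by
    have hQ : MeasurePreserving (planeRotation (n := n) i j t) volume volume :=
      (planeRotationEquiv hij t).measurePreserving
    refine ⟨hQ.measurable, ?_⟩
    ext s hs
    rw [Measure.map_apply hQ.measurable hs, sphereMeasure_apply (hQ.measurable hs),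
      sphereMeasure_apply hs]
    congr 1
    have e : Ioo (0 : ℝ) 1 • (planeRotation i j t ⁻¹' s ∩ Metric.sphere 0 1)
        = planeRotation i j t ⁻¹' (Ioo (0 : ℝ) 1 • (s ∩ Metric.sphere 0 1)) := by
      ext x
      simp only [mem_smul, mem_preimage, mem_inter_iff, mem_sphere_zero_iff_norm]
      constructor
      · rintro ⟨c, hc, y, ⟨hy1, hy2⟩, rfl⟩
        exact ⟨c, hc, planeRotation i j t y, ⟨hy1, by rwa [norm_planeRotation hij]⟩,
          ((planeRotationEquiv hij t).map_smul c y).symm⟩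
      · rintro ⟨c, hc, y, ⟨hy1, hy2⟩, hxy⟩
        refine ⟨c, hc, planeRotation i j (-t) y, ⟨?_, by rwa [norm_planeRotation hij]⟩, ?_⟩
        · rwa [planeRotation_cancel_neg hij]
        · rw [← planeRotation_neg_cancel hij t x, ← hxy]
          exact ((planeRotationEquiv hij (-t)).map_smul c y).symm
    rw [e]
    exact hQ.measure_preimage_emb
      (planeRotationEquiv hij t).toHomeomorph.measurableEmbedding _
  measure_pos U hU hUK := by
    rw [sphereMeasure, Measure.map_apply measurable_subtype_coe hU.measurableSet]
    obtain ⟨x, hxU, hxK⟩ := hUK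
    exact (hU.preimage continuous_subtype_val).measure_ne_zero _ ⟨⟨x, hxK⟩, hxU⟩

/-! ### Projecting the lifted measure to the ball -/

/-- The projection onto the first `d` coordinates. -/
def proj {d : ℕ} (y : E (d + 1)) : E d := WithLp.toLp 2 fun k : Fin d => y k.castSucc

theorem lift_eq_comp {d : ℕ} (f : E d → ℝ) : lift f = f ∘ proj := rfl

theorem continuous_proj {d : ℕ} : Continuous (proj (d := d)) :=
  (PiLp.continuous_toLp 2 _).comp (continuous_pi fun k => by fun_prop)

theorem norm_sq_eq_proj {d : ℕ} (y : E (d + 1)) :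
    ‖y‖ ^ 2 = ‖proj y‖ ^ 2 + y (Fin.last d) ^ 2 := by
  rw [EuclideanSpace.real_norm_sq_eq, EuclideanSpace.real_norm_sq_eq, Fin.sum_univ_castSucc]
  rfl

theorem norm_proj_le {d : ℕ} (y : E (d + 1)) : ‖proj y‖ ≤ ‖y‖ := by
  refine le_of_sq_le_sq ?_ (norm_nonneg _)
  rw [norm_sq_eq_proj y]
  nlinarith [sq_nonneg (y (Fin.last d))]

theorem measurePreserving_proj_last (d : ℕ) :
    MeasurePreserving (fun y : E (d + 1) => (proj y, y (Fin.last d))) volume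
      ((volume : Measure (E d)).prod volume) := by
  have h1 := PiLp.volume_preserving_ofLp (Fin (d + 1))
  have h2 := volume_preserving_piFinSuccAbove (fun _ : Fin (d + 1) => ℝ) (Fin.last d)
  have h3 := Measure.measurePreserving_swap (μ := (volume : Measure ℝ))
    (ν := (volume : Measure (Fin d → ℝ)))
  have h4 := (PiLp.volume_preserving_toLp (Fin d)).prod (MeasurePreserving.id (volume : Measure ℝ))
  have h := h4.comp (h3.comp (h2.comp h1))
  have e : (fun y : E (d + 1) => (proj y, y (Fin.last d))) = Prod.map (WithLp.toLp 2) id ∘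
      Prod.swap ∘ (MeasurableEquiv.piFinSuccAbove (fun _ => ℝ) (Fin.last d)) ∘ WithLp.ofLp := by
    funext y
    refine Prod.ext ?_ rfl
    ext k
    simp [proj, MeasurableEquiv.piFinSuccAbove, Fin.insertNthEquiv, Fin.init]
  rw [e]
  exact h

/-- The integral of `(1 - u²)^e` over `(-1, 1)`, which is finite for `e ≥ -1/2`. -/
def sliceConst (e : ℝ) : ℝ≥0∞ :=
  ∫⁻ u in Metric.ball (0 : ℝ) 1, ENNReal.ofReal ((1 - ‖u‖ ^ 2) ^ e)

theorem sliceConst_ne_top {e : ℝ} (he : -1 / 2 ≤ e) : sliceConst e ≠ ⊤ :=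
  ((hasFiniteIntegral_iff_ofReal (ae_restrict_of_forall_mem measurableSet_ball fun u hu => by
    have : ‖u‖ < 1 := by simpa using hu
    have : 0 ≤ 1 - ‖u‖ ^ 2 := by nlinarith [norm_nonneg u]
    exact Real.rpow_nonneg this _)).1 (integrableOn_one_sub_norm_sq_rpow volume he).2).ne

/-- Substitute `t = √w u`: the integrand contributes `w^e`, the differential `w^(1/2)`. -/
theorem lintegral_slice {e w : ℝ} (hw : 0 < w) :
    ∫⁻ t : ℝ, {t : ℝ | t ^ 2 < w}.indicator (fun t => ENNReal.ofReal ((w - t ^ 2) ^ e)) t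
      = sliceConst e * ENNReal.ofReal (w ^ (e + 1 / 2)) := by
  have hs : 0 < √w := Real.sqrt_pos.2 hw
  have hm : Measurable
      ({t : ℝ | t ^ 2 < w}.indicator fun t => ENNReal.ofReal ((w - t ^ 2) ^ e)) :=
    Measurable.indicator (by fun_prop) (measurableSet_lt (by fun_prop) (by fun_prop))
  rw [← Real.smul_map_volume_mul_left hs.ne', lintegral_smul_measure,
    lintegral_map hm (measurable_const_mul _), sliceConst,
    ← lintegral_indicator Metric.isOpen_ball.measurableSet]
  have e1 : ∀ u : ℝ, {t : ℝ | t ^ 2 < w}.indicator (fun t => ENNReal.ofReal ((w - t ^ 2) ^ e))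
      (√w * u) = ENNReal.ofReal (w ^ e) * (Metric.ball (0 : ℝ) 1).indicator
        (fun u => ENNReal.ofReal ((1 - ‖u‖ ^ 2) ^ e)) u := by
    intro u
    have hsq : (√w * u) ^ 2 = w * u ^ 2 := by rw [mul_pow, Real.sq_sqrt hw.le]
    by_cases hu : |u| < 1
    · have hu2 : u ^ 2 < 1 := (sq_lt_one_iff_abs_lt_one u).2 hu
      rw [indicator_of_mem (by rw [mem_ofPred_eq, hsq]; nlinarith),
        indicator_of_mem (by simpa using hu), ← ENNReal.ofReal_mul (by positivity),
        ← Real.mul_rpow hw.le (by simpa using hu2.le), hsq, Real.norm_eq_abs, sq_abs]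
      ring_nf
    · have hu2 : 1 ≤ u ^ 2 := by
        rw [← not_lt, sq_lt_one_iff_abs_lt_one]; exact hu
      rw [indicator_of_notMem (by rw [mem_ofPred_eq, hsq]; nlinarith),
        indicator_of_notMem (by simpa using hu), mul_zero]
  simp only [e1]
  rw [lintegral_const_mul' _ _ ENNReal.ofReal_ne_top, abs_of_pos hs, smul_eq_mul, ← mul_assoc,
    ← ENNReal.ofReal_mul hs.le, mul_comm, Real.sqrt_eq_rpow, ← Real.rpow_add hw, add_comm]

/-- Tonelli over the vertical fibres: with `w = 1 - ‖x‖²`, integrating `(w - t²)^(μ-1)` in `t` gives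
a multiple of `w^(μ-1/2)`, the weight on the ball. -/
theorem map_proj_ballMeasure_le {d : ℕ} (μ : ℝ) :
    (ballMeasure (d + 1) (μ - 1 / 2)).map proj ≤ sliceConst (μ - 1) • ballMeasure d μ := by
  refine Measure.le_iff.2 fun A hA => ?_
  have hA' : MeasurableSet (proj ⁻¹' A : Set (E (d + 1))) := continuous_proj.measurable hA
  rw [Measure.map_apply continuous_proj.measurable hA, Measure.smul_apply, ballMeasure_eq,
    ballMeasure_eq, withDensity_apply _ hA', withDensity_apply _ hA, smul_eq_mul,
    ← lintegral_indicator hA', ← lintegral_indicator hA]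
  let G : E d × ℝ → ℝ≥0∞ := fun q => A.indicator (fun x => {t : ℝ | t ^ 2 < 1 - ‖x‖ ^ 2}.indicator
    (fun t => ENNReal.ofReal ((1 - ‖x‖ ^ 2 - t ^ 2) ^ (μ - 1))) q.2) q.1
  have hG : Measurable G := by
    have : G = ({q : E d × ℝ | q.1 ∈ A} ∩ {q | q.2 ^ 2 < 1 - ‖q.1‖ ^ 2}).indicator
        (fun q => ENNReal.ofReal ((1 - ‖q.1‖ ^ 2 - q.2 ^ 2) ^ (μ - 1))) := by
      ext q
      by_cases h1 : q.1 ∈ A <;> by_cases h2 : q.2 ^ 2 < 1 - ‖q.1‖ ^ 2 <;> simp [G, h1, h2]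
    rw [this]
    exact Measurable.indicator (by fun_prop)
      ((measurable_fst hA).inter (measurableSet_lt (by fun_prop) (by fun_prop)))
  have e1 : ∀ y : E (d + 1), (proj ⁻¹' A).indicator (ballDensity (d + 1) (μ - 1 / 2)) y
      = G (proj y, y (Fin.last d)) := by
    intro y
    by_cases h1 : proj y ∈ A
    · rw [indicator_of_mem (by exact h1)]
      simp only [G]
      rw [indicator_of_mem h1, ballDensity]
      have h3 : ‖y‖ < 1 ↔ y (Fin.last d) ^ 2 < 1 - ‖proj y‖ ^ 2 := by
        rw [← sq_lt_one_iff₀ (norm_nonneg y), norm_sq_eq_proj]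
        constructor <;> intro h <;> linarith
      by_cases h2 : ‖y‖ < 1
      · rw [indicator_of_mem (by simpa using h2), indicator_of_mem (by exact h3.1 h2),
          norm_sq_eq_proj]
        ring_nf
      · rw [indicator_of_notMem (by simpa using h2),
          indicator_of_notMem (by rw [mem_ofPred_eq, ← h3]; exact h2)]
    · rw [indicator_of_notMem (by exact h1)]
      simp only [G]
      rw [indicator_of_notMem h1]
  simp only [e1]
  rw [(measurePreserving_proj_last d).lintegral_comp hG, lintegral_prod _ hG.aemeasurable,
    ← lintegral_const_mul _ ((measurable_ballDensity d μ).indicator hA)]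
  refine lintegral_mono fun x => ?_
  by_cases h1 : x ∈ A
  · simp only [G, indicator_of_mem h1]
    by_cases h2 : ‖x‖ < 1
    · have hw : 0 < 1 - ‖x‖ ^ 2 := by nlinarith [norm_nonneg x]
      rw [lintegral_slice hw, ballDensity, indicator_of_mem (by simpa using h2)]
      ring_nf
      exact le_rfl
    · have hw : 1 - ‖x‖ ^ 2 ≤ 0 := by nlinarith
      have : {t : ℝ | t ^ 2 < 1 - ‖x‖ ^ 2} = ∅ := by
        ext t
        simp only [mem_ofPred_eq, mem_empty_iff_false, iff_false, not_lt]
        exact hw.trans (sq_nonneg t)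
      simp [this]
  · simp [G, indicator_of_notMem h1]

/-- The inverse, on the slice at height `t`, of the radial projection to the sphere followed by the
orthogonal projection to the ball. -/
def coneMap (d : ℕ) (t : ℝ) (x : E d) : E d := (|t| * (1 - ‖x‖ ^ 2) ^ (-1 / 2 : ℝ)) • x

/-- With `w = 1 - ‖x‖²` and `c = |t| w^(-1/2) ≤ 1`, the derivative is `c` times the rank-one
perturbation `v ↦ v + w⁻¹⟨x, v⟩ x` of the identity. Its determinant is `c^d (1 + ‖x‖²/w) = c^d / w`.
-/
theorem exists_hasFDerivAt_coneMap {d : ℕ} {t : ℝ} {x : E d} (hx : t ^ 2 < 1 - ‖x‖ ^ 2) :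
    ∃ L : E d →L[ℝ] E d, HasFDerivAt (coneMap d t) L x ∧ |L.det| ≤ (1 - ‖x‖ ^ 2)⁻¹ := by
  set w := 1 - ‖x‖ ^ 2 with hw
  have hw0 : 0 < w := (sq_nonneg t).trans_lt hx
  have h1 : HasFDerivAt (fun x : E d => 1 - ‖x‖ ^ 2) (-(2 • innerSL ℝ x)) x :=
    (hasStrictFDerivAt_norm_sq x).hasFDerivAt.const_sub 1
  have h2 := (h1.rpow_const (p := (-1 / 2 : ℝ)) (Or.inl hw0.ne')).const_mul |t|
  have h3 := h2.smul (hasFDerivAt_id x)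
  refine ⟨_, h3, ?_⟩
  set c := |t| * w ^ (-1 / 2 : ℝ) with hc
  have hc0 : 0 ≤ c := by positivity
  have hc1 : c ≤ 1 := by
    have ht : |t| ≤ √w := Real.abs_le_sqrt hx.le
    have e : (w ^ (-1 / 2 : ℝ)) = (√w)⁻¹ := by
      rw [Real.sqrt_eq_rpow, ← Real.rpow_neg hw0.le]; norm_num
    rw [hc, e, ← div_eq_mul_inv]
    exact (div_le_one (Real.sqrt_pos.2 hw0)).2 ht
  have hL : ∀ L : E d →L[ℝ] E d, (∀ v, L v = c • (v + (w⁻¹ * inner ℝ x v) • x)) →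
      |L.det| ≤ w⁻¹ := by
    intro L hL
    have e : (L : E d →ₗ[ℝ] E d)
        = c • LinearMap.transvection (w⁻¹ • (innerSL ℝ x).toLinearMap) x := by
      ext1 v
      rw [LinearMap.smul_apply, LinearMap.transvection.apply]
      simpa using hL v
    rw [ContinuousLinearMap.det, e, LinearMap.det_smul, LinearMap.transvection.det, abs_mul,
      abs_pow, abs_of_nonneg hc0]
    have e2 : 1 + (w⁻¹ • (innerSL ℝ x).toLinearMap) x = w⁻¹ := by
      simp only [LinearMap.smul_apply, ContinuousLinearMap.coe_coe, innerSL_apply_apply,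
        real_inner_self_eq_norm_sq, smul_eq_mul]
      have : ‖x‖ ^ 2 = 1 - w := by rw [hw]; ring
      rw [this]
      field_simp
      ring
    rw [e2, abs_of_pos (inv_pos.2 hw0)]
    exact mul_le_of_le_one_left (inv_pos.2 hw0).le (pow_le_one₀ hc0 hc1)
  refine hL _ fun v => ?_
  have e3 : w ^ ((-1 / 2 : ℝ) - 1) = w ^ (-1 / 2 : ℝ) * w⁻¹ := by
    rw [Real.rpow_sub_one hw0.ne', div_eq_mul_inv]
  simp only [add_apply, smul_apply,
    ContinuousLinearMap.smulRight_apply, neg_apply, innerSL_apply_apply,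
    ContinuousLinearMap.id_apply, id, smul_eq_mul, ← hw, e3, smul_add, smul_smul,
    nsmul_eq_mul, Nat.cast_ofNat]
  congr 2
  rw [hc]
  ring

/-- With `s = ‖(x, t)‖`, the preimage is `s⁻¹ x`, the projection of the normalised point `s⁻¹ (x,
t)`; there `1 - ‖s⁻¹ x‖² = t²/s²`. -/
theorem mem_image_coneMap {d : ℕ} {t : ℝ} (ht : t ≠ 0) {A : Set (E d)} {x : E d}
    (hx : ‖x‖ ^ 2 + t ^ 2 < 1) (hxA : (√(‖x‖ ^ 2 + t ^ 2))⁻¹ • x ∈ A) :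
    x ∈ coneMap d t '' (A ∩ {x | t ^ 2 < 1 - ‖x‖ ^ 2}) := by
  have ht2 : 0 < t ^ 2 := by positivity
  set s := √(‖x‖ ^ 2 + t ^ 2) with hs
  have hs2 : s ^ 2 = ‖x‖ ^ 2 + t ^ 2 := Real.sq_sqrt (by positivity)
  have hs0 : 0 < s := Real.sqrt_pos.2 (by positivity)
  have hw : 1 - ‖s⁻¹ • x‖ ^ 2 = (|t| / s) ^ 2 := by
    rw [norm_smul, norm_inv, Real.norm_of_nonneg hs0.le, mul_pow, div_pow, sq_abs, inv_pow, hs2]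
    field_simp
    ring
  refine ⟨s⁻¹ • x, ⟨hxA, ?_⟩, ?_⟩
  · rw [mem_ofPred_eq, hw, div_pow, sq_abs, lt_div_iff₀ (by positivity), hs2]
    nlinarith
  · have htp : 0 < |t| := abs_pos.2 ht
    have e : ((|t| / s) ^ 2) ^ (-1 / 2 : ℝ) = (|t| / s)⁻¹ := by
      rw [← Real.rpow_natCast, ← Real.rpow_mul (by positivity), ← Real.rpow_neg_one]
      norm_num
    rw [coneMap, hw, e, smul_smul]
    have : |t| * (|t| / s)⁻¹ * s⁻¹ = 1 := by field_simp
    rw [this, one_smul]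

theorem volume_coneSlice_le {d : ℕ} {t : ℝ} (ht : t ≠ 0) {A : Set (E d)} (hA : MeasurableSet A) :
    volume {x : E d | ‖x‖ ^ 2 + t ^ 2 < 1 ∧ (√(‖x‖ ^ 2 + t ^ 2))⁻¹ • x ∈ A}
      ≤ ∫⁻ x in A ∩ {x | t ^ 2 < 1 - ‖x‖ ^ 2}, ENNReal.ofReal ((1 - ‖x‖ ^ 2)⁻¹) := by
  have hB : MeasurableSet (A ∩ {x : E d | t ^ 2 < 1 - ‖x‖ ^ 2}) :=
    hA.inter (measurableSet_lt (by fun_prop) (by fun_prop))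
  classical
  let L : E d → E d →L[ℝ] E d := fun x => if hx : t ^ 2 < 1 - ‖x‖ ^ 2 then
    (exists_hasFDerivAt_coneMap hx).choose else 0
  have hL : ∀ x, t ^ 2 < 1 - ‖x‖ ^ 2 →
      HasFDerivAt (coneMap d t) (L x) x ∧ |(L x).det| ≤ (1 - ‖x‖ ^ 2)⁻¹ := fun x hx => by
    simp only [L, dif_pos hx]
    exact (exists_hasFDerivAt_coneMap hx).choose_spec
  calc _ ≤ volume (coneMap d t '' (A ∩ {x | t ^ 2 < 1 - ‖x‖ ^ 2})) :=
        measure_mono fun x hx => mem_image_coneMap ht hx.1 hx.2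
    _ ≤ ∫⁻ x in A ∩ {x | t ^ 2 < 1 - ‖x‖ ^ 2}, ENNReal.ofReal |(L x).det| :=
        addHaar_image_le_lintegral_abs_det_fderiv volume hB fun x hx =>
          (hL x hx.2).1.hasFDerivWithinAt
    _ ≤ _ := setLIntegral_mono' hB fun x hx => ENNReal.ofReal_le_ofReal (hL x hx.2).2

open scoped Pointwise in
-- The cone over the set is cut into horizontal slices, each bounded by the Jacobian estimate.
-- Tonelli then integrates `w⁻¹`, `w = 1 - ‖x‖²`, over `t² < w`, giving a multiple of `w^(-1/2)`,
-- the weight for `μ = 0`. The slice formula is used with exponent zero.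
theorem map_proj_sphereMeasure_le (d : ℕ) :
    (sphereMeasure (d + 1)).map proj ≤ (((d + 1 : ℕ) : ℝ≥0∞) * sliceConst 0) • ballMeasure d 0 := by
  refine Measure.le_iff.2 fun A hA => ?_
  have hA' : MeasurableSet (proj ⁻¹' A : Set (E (d + 1))) := continuous_proj.measurable hA
  rw [Measure.map_apply continuous_proj.measurable hA, sphereMeasure_apply hA',
    Measure.smul_apply, smul_eq_mul, mul_assoc]
  gcongr
  rw [ballMeasure_eq, withDensity_apply _ hA]
  let G : Set (E d × ℝ) :=
    {q | ‖q.1‖ ^ 2 + q.2 ^ 2 < 1 ∧ (√(‖q.1‖ ^ 2 + q.2 ^ 2))⁻¹ • q.1 ∈ A}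
  have hG : MeasurableSet G := by
    have h1 : MeasurableSet {q : E d × ℝ | ‖q.1‖ ^ 2 + q.2 ^ 2 < 1} :=
      measurableSet_lt (by fun_prop) (by fun_prop)
    refine h1.inter ?_
    have : Measurable fun q : E d × ℝ => (√(‖q.1‖ ^ 2 + q.2 ^ 2))⁻¹ • q.1 := by fun_prop
    exact this hA
  have hsub : Ioo (0 : ℝ) 1 • (proj ⁻¹' A ∩ Metric.sphere (0 : E (d + 1)) 1)
      ⊆ (fun y : E (d + 1) => (proj y, y (Fin.last d))) ⁻¹' G := by
    rintro _ ⟨c, hc, y, ⟨hy1, hy2⟩, rfl⟩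
    have hn : ‖c • y‖ = c := by
      rw [norm_smul, mem_sphere_zero_iff_norm.1 hy2, mul_one, Real.norm_of_nonneg hc.1.le]
    have hp : proj (c • y) = c • proj y := rfl
    simp only [mem_preimage, G, mem_ofPred_eq, ← norm_sq_eq_proj, hn]
    refine ⟨by nlinarith [hc.1, hc.2], ?_⟩
    rw [Real.sqrt_sq hc.1.le, hp, inv_smul_smul₀ hc.1.ne']
    exact hy1
  refine (measure_mono hsub).trans ?_
  rw [(measurePreserving_proj_last d).measure_preimage hG.nullMeasurableSet,
    Measure.prod_apply_symm hG]
  let J : E d → ℝ → ℝ≥0∞ := fun x t => A.indicator (fun x => ENNReal.ofReal ((1 - ‖x‖ ^ 2)⁻¹)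
    * {t : ℝ | t ^ 2 < 1 - ‖x‖ ^ 2}.indicator
      (fun t => ENNReal.ofReal ((1 - ‖x‖ ^ 2 - t ^ 2) ^ (0 : ℝ))) t) x
  have hJ : Measurable (Function.uncurry J) := by
    have : Function.uncurry J = ({q : E d × ℝ | q.1 ∈ A} ∩ {q | q.2 ^ 2 < 1 - ‖q.1‖ ^ 2}).indicator
        (fun q => ENNReal.ofReal ((1 - ‖q.1‖ ^ 2)⁻¹)) := by
      ext q
      by_cases h1 : q.1 ∈ A <;> by_cases h2 : q.2 ^ 2 < 1 - ‖q.1‖ ^ 2 <;>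
        simp [J, Function.uncurry, h1, h2]
    rw [this]
    exact Measurable.indicator (by fun_prop)
      ((measurable_fst hA).inter (measurableSet_lt (by fun_prop) (by fun_prop)))
  have hslice : ∀ᵐ t : ℝ, volume ((fun x => (x, t)) ⁻¹' G) ≤ ∫⁻ x, J x t := by
    have h0 : ∀ᵐ t : ℝ, t ≠ 0 := by simp [ae_iff]
    filter_upwards [h0] with t ht
    refine (volume_coneSlice_le ht hA).trans_eq ?_
    rw [← lintegral_indicator (hA.inter (measurableSet_lt (by fun_prop) (by fun_prop)))]
    refine lintegral_congr fun x => ?_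
    by_cases h1 : x ∈ A <;> by_cases h2 : t ^ 2 < 1 - ‖x‖ ^ 2 <;> simp [J, h1, h2]
  refine (lintegral_mono_ae hslice).trans ?_
  rw [← lintegral_lintegral_swap hJ.aemeasurable,
    ← lintegral_const_mul _ (measurable_ballDensity d 0), ← lintegral_indicator hA]
  refine lintegral_mono fun x => ?_
  by_cases h1 : x ∈ A
  · simp only [J, indicator_of_mem h1]
    by_cases h2 : ‖x‖ < 1
    · have hw : 0 < 1 - ‖x‖ ^ 2 := by nlinarith [norm_nonneg x]
      rw [lintegral_const_mul' _ _ ENNReal.ofReal_ne_top, lintegral_slice hw, ballDensity,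
        indicator_of_mem (by simpa using h2), mul_left_comm, ← ENNReal.ofReal_mul (by positivity)]
      rw [← Real.rpow_neg_one, ← Real.rpow_add hw]
      norm_num
    · have hw : 1 - ‖x‖ ^ 2 ≤ 0 := by nlinarith
      have : {t : ℝ | t ^ 2 < 1 - ‖x‖ ^ 2} = ∅ := by
        ext t
        simp only [mem_ofPred_eq, mem_empty_iff_false, iff_false, not_lt]
        exact hw.trans (sq_nonneg t)
      simp [this]
  · simp [J, indicator_of_notMem h1]

/-- The projection of the lifted measure is dominated by the measure on the ball. -/
theorem exists_map_proj_liftMeasure_le (d : ℕ) {m : ℕ} (hm : 1 ≤ m) {μ : ℝ}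
    (hμ : μ = ((m : ℝ) - 1) / 2) :
    ∃ C : ℝ≥0∞, C ≠ ⊤ ∧ (liftMeasure d μ).map proj ≤ C • ballMeasure d μ := by
  by_cases h0 : μ = 0
  · refine ⟨_, ENNReal.mul_ne_top (ENNReal.natCast_ne_top (d + 1))
      (sliceConst_ne_top (e := 0) (by norm_num)), ?_⟩
    rw [liftMeasure, if_pos h0, h0]
    exact map_proj_sphereMeasure_le d
  · refine ⟨_, sliceConst_ne_top (e := μ - 1) ?_, ?_⟩
    -- `μ ≠ 0` excludes `m = 1`, and `m ≥ 2` is exactly `μ - 1 ≥ -1/2`, the range in which the fibre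
    -- integral is known to be finite.
    · have : 2 ≤ m := by
        rcases hm.lt_or_eq with h | h
        · exact h
        · exact absurd (by rw [hμ, ← h]; simp) h0
      have : (2 : ℝ) ≤ m := by exact_mod_cast this
      rw [hμ]; linarith
    · rw [liftMeasure, if_neg h0]
      exact map_proj_ballMeasure_le μ

theorem liftMeasure_rotationInvariant (d : ℕ) {m : ℕ} (hm : 1 ≤ m) {μ : ℝ}
    (hμ : μ = ((m : ℝ) - 1) / 2) : RotationInvariant (liftDomain d μ) (liftMeasure d μ) := by
  by_cases h0 : μ = 0
  · rw [liftDomain, liftMeasure, if_pos h0, if_pos h0]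
    exact sphereMeasure_rotationInvariant _
  · rw [liftDomain, liftMeasure, if_neg h0, if_neg h0]
    refine ballMeasure_rotationInvariant (Nat.le_add_left _ _) ?_
    have : 2 ≤ m := by
      rcases hm.lt_or_eq with h | h
      · exact h
      · exact absurd (by rw [hμ, ← h]; simp) h0
    have : (2 : ℝ) ≤ m := by exact_mod_cast this
    rw [hμ]; linarith

theorem proj_mem_closedBall {d : ℕ} {μ : ℝ} {y : E (d + 1)} (hy : y ∈ liftDomain d μ) :
    proj y ∈ Metric.closedBall (0 : E d) 1 := by
  rw [mem_closedBall_zero_iff]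
  refine (norm_proj_le y).trans ?_
  rw [liftDomain] at hy
  split_ifs at hy
  · exact (mem_sphere_zero_iff_norm.1 hy).le
  · exact mem_closedBall_zero_iff.1 hy

theorem memSpace_lift {d m : ℕ} (hm : 1 ≤ m) {μ : ℝ} (hμ : μ = ((m : ℝ) - 1) / 2) {p : ℝ≥0∞}
    {f : E d → ℝ} (hf : MemSpace p (Metric.closedBall 0 1) (ballMeasure d μ) f) :
    MemSpace p (liftDomain d μ) (liftMeasure d μ) (lift f) := by
  obtain ⟨C, hC, hle⟩ := exists_map_proj_liftMeasure_le d hm hμ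
  exact ⟨(hf.1.of_measure_le_smul hC hle).comp_of_map continuous_proj.aemeasurable, fun hp =>
    (hf.2 hp).comp continuous_proj.continuousOn fun _ => proj_mem_closedBall⟩

theorem exists_eLpNorm_lift_le (d : ℕ) {m : ℕ} (hm : 1 ≤ m) {μ : ℝ} (hμ : μ = ((m : ℝ) - 1) / 2)
    (p : ℝ≥0∞) : ∃ C : ℝ≥0∞, C ≠ ⊤ ∧ ∀ f, MemSpace p (Metric.closedBall 0 1) (ballMeasure d μ) f →
      eLpNorm (lift f) p (liftMeasure d μ) ≤ C * eLpNorm f p (ballMeasure d μ) := by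
  obtain ⟨C, hC, hle⟩ := exists_map_proj_liftMeasure_le d hm hμ
  -- For `p = ∞` the exponent is `0` and the constant is one.
  refine ⟨C ^ (1 / p).toReal, ENNReal.rpow_ne_top_of_nonneg ENNReal.toReal_nonneg hC,
    fun f hf => ?_⟩
  rw [lift_eq_comp, ← eLpNorm_map_measure (hf.1.of_measure_le_smul hC hle).1
    continuous_proj.aemeasurable]
  exact eLpNorm_le_of_measure_le_smul hle

/-! ### Comparison of the two norms -/

section norms

variable {d m r l : ℕ} {μ α : ℝ} {p : ℝ≥0∞}

theorem modulus_le (hd : 1 ≤ d) (hm : 1 ≤ m) (hr : 1 ≤ r) (hμ : μ = ((m : ℝ) - 1) / 2)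
    (hp : 1 ≤ p) (hα0 : 0 ≤ α) {f : E d → ℝ}
    (hf : MemSpace p (Metric.closedBall 0 1) (ballMeasure d μ) f) {t : ℝ} (ht1 : t ≤ 1) :
    modulus d μ p (r + l) f t ≤ ENNReal.ofReal (t ^ ((r : ℝ) + α)) *
      ((⨆ (i : Fin d) (j : Fin d) (_ : i < j),
        lipSeminorm p r l α (Metric.closedBall 0 1) (ballMeasure d μ) i j f)
      + ⨆ i : Fin d, lipSeminorm p r l α (liftDomain d μ) (liftMeasure d μ) i.castSucc (Fin.last d)
          (lift f)) := by
  have hμ0 : 0 ≤ μ := by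
    have : (1 : ℝ) ≤ m := by exact_mod_cast hm
    rw [hμ]; linarith
  refine iSup₂_le fun θ hθ => ?_
  have hpow : ENNReal.ofReal (|θ| ^ ((r : ℝ) + α)) ≤ ENNReal.ofReal (t ^ ((r : ℝ) + α)) :=
    ENNReal.ofReal_le_ofReal (Real.rpow_le_rpow (abs_nonneg _) hθ (by positivity))
  refine max_le (iSup_le fun i => iSup₂_le fun j hij => ?_) (iSup_le fun i => ?_)
  · refine ((ballMeasure_rotationInvariant hd hμ0).eLpNorm_angDiff_le_lipSeminorm hp hij.ne hr l
      (hθ.trans ht1) hf (α := α)).trans (mul_le_mul' hpow ?_)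
    refine le_add_right ?_
    exact le_iSup_of_le i (le_iSup₂_of_le j hij le_rfl)
  · refine ((liftMeasure_rotationInvariant d hm hμ).eLpNorm_angDiff_le_lipSeminorm hp
      (Fin.castSucc_lt_last i).ne hr l (hθ.trans ht1) (memSpace_lift hm hμ hf) (α := α)).trans
      (mul_le_mul' hpow ?_)
    refine le_add_left ?_
    exact le_iSup_of_le i le_rfl

theorem holderNorm_le_lipNorm (hd : 1 ≤ d) (hm : 1 ≤ m) (hr : 1 ≤ r)
    (hμ : μ = ((m : ℝ) - 1) / 2) (hp : 1 ≤ p) (hα0 : 0 ≤ α) {f : E d → ℝ}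
    (hf : MemSpace p (Metric.closedBall 0 1) (ballMeasure d μ) f) :
    holderNorm d μ p r l α f ≤ lipNorm d μ p r l α f := by
  rw [holderNorm, lipNorm, add_assoc]
  gcongr
  refine iSup₂_le fun t ht => ENNReal.div_le_of_le_mul' ?_
  exact modulus_le hd hm hr hμ hp hα0 hf ht.2

theorem modulus_abs_le (f : E d → ℝ) {θ : ℝ} (hθ0 : θ ≠ 0) (hθ1 : |θ| ≤ 1) :
    modulus d μ p (r + l) f |θ| ≤ (⨆ (t : ℝ) (_ : 0 < t ∧ t ≤ 1),
        modulus d μ p (r + l) f t / ENNReal.ofReal (t ^ ((r : ℝ) + α)))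
      * ENNReal.ofReal (|θ| ^ ((r : ℝ) + α)) := by
  have hθ := abs_pos.2 hθ0
  have h0 : ENNReal.ofReal (|θ| ^ ((r : ℝ) + α)) ≠ 0 := by
    rw [Ne, ENNReal.ofReal_eq_zero, not_le]
    positivity
  rw [← ENNReal.div_le_iff_le_mul (Or.inl h0) (Or.inl ENNReal.ofReal_ne_top)]
  exact le_iSup₂_of_le |θ| ⟨hθ, hθ1⟩ le_rfl

theorem exists_lipNorm_le_holderNorm (hd : 1 ≤ d) (hm : 1 ≤ m) (hr : 1 ≤ r) (hl : 1 ≤ l)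
    (hμ : μ = ((m : ℝ) - 1) / 2) (hp : 1 ≤ p) (hα0 : 0 < α) (hα1 : α < 1) :
    ∃ C : ℝ, 1 ≤ C ∧ ∀ f : E d → ℝ,
      MemSpace p (Metric.closedBall 0 1) (ballMeasure d μ) f → holderNorm d μ p r l α f < ⊤ →
      lipNorm d μ p r l α f ≤ ENNReal.ofReal C * holderNorm d μ p r l α f := by
  have hμ0 : 0 ≤ μ := by
    have : (1 : ℝ) ≤ m := by exact_mod_cast hm
    rw [hμ]; linarith
  obtain ⟨C₁, -, h₁⟩ :=
    (ballMeasure_rotationInvariant hd hμ0).exists_lipSeminorm_le hp r l hl hα0 hα1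
  obtain ⟨C₂, -, h₂⟩ :=
    (liftMeasure_rotationInvariant d hm hμ).exists_lipSeminorm_le hp r l hl hα0 hα1
  obtain ⟨C₃, hC₃, h₃⟩ := exists_eLpNorm_lift_le d hm hμ p
  -- One summand for each part of the Lipschitz norm: the `L^p` norm, the planes inside the ball,
  -- and the lifted planes, where `C₃` bounds the norm of the lift.
  set c : ℝ≥0∞ := 1 + ENNReal.ofReal C₁ + ENNReal.ofReal C₂ * (1 + C₃) with hc
  have hct : c ≠ ⊤ := by
    rw [hc]
    finiteness
  refine ⟨c.toReal, ?_, fun f hf hH => ?_⟩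
  · rw [← ENNReal.toReal_one]
    exact ENNReal.toReal_mono hct (by rw [hc, add_assoc]; exact le_self_add)
  rw [ENNReal.ofReal_toReal hct, lipNorm]
  set N := holderNorm d μ p r l α f with hN
  set A : ℝ≥0∞ := ⨆ (t : ℝ) (_ : 0 < t ∧ t ≤ 1),
    modulus d μ p (r + l) f t / ENNReal.ofReal (t ^ ((r : ℝ) + α)) with hA
  have hNA : N = eLpNorm f p (ballMeasure d μ) + A := rfl
  have hAN : A ≤ N := le_add_self
  have hfN : eLpNorm f p (ballMeasure d μ) ≤ N := le_self_add
  have hAt : A ≠ ⊤ := (hAN.trans_lt hH).ne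
  have b1 : (⨆ (i : Fin d) (j : Fin d) (_ : i < j),
      lipSeminorm p r l α (Metric.closedBall 0 1) (ballMeasure d μ) i j f)
      ≤ ENNReal.ofReal C₁ * N := by
    refine iSup_le fun i => iSup₂_le fun j hij => ?_
    rw [hNA, add_comm]
    refine h₁ i j hij.ne f hf A hAt fun θ hθ => ?_
    rcases eq_or_ne θ 0 with rfl | hθ0
    · rw [angDiff_zero_angle (by omega)]
      simp
    · refine le_trans ?_ (modulus_abs_le f hθ0 hθ)
      refine le_iSup₂_of_le θ le_rfl (le_max_of_le_left ?_)
      exact le_iSup_of_le i (le_iSup₂_of_le j hij le_rfl)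
  have b2 : (⨆ i : Fin d, lipSeminorm p r l α (liftDomain d μ) (liftMeasure d μ) i.castSucc
      (Fin.last d) (lift f)) ≤ ENNReal.ofReal C₂ * (1 + C₃) * N := by
    refine iSup_le fun i => ?_
    refine (h₂ i.castSucc (Fin.last d) (Fin.castSucc_lt_last i).ne (lift f) (memSpace_lift hm hμ hf)
      A hAt fun θ hθ => ?_).trans ?_
    · rcases eq_or_ne θ 0 with rfl | hθ0
      · rw [angDiff_zero_angle (by omega)]
        simp
      · refine le_trans ?_ (modulus_abs_le f hθ0 hθ)
        refine le_iSup₂_of_le θ le_rfl (le_max_of_le_right ?_)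
        exact le_iSup_of_le i le_rfl
    · rw [mul_assoc, add_mul, one_mul]
      gcongr
      exact (h₃ f hf).trans (by gcongr)
  calc _ ≤ N + ENNReal.ofReal C₁ * N + ENNReal.ofReal C₂ * (1 + C₃) * N := by gcongr
    _ = c * N := by rw [hc, add_mul, add_mul, one_mul]

end norms

end BallLip

end

theorem mainTheorem8 (d m r l : ℕ) (hd : 1 ≤ d) (hm : 1 ≤ m) (hr : 1 ≤ r) (hl : 1 ≤ l)
    (μ : ℝ) (hμ : μ = ((m : ℝ) - 1) / 2) (p : ℝ≥0∞) (hp : 1 ≤ p)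
    (α : ℝ) (hα0 : 0 ≤ α) (hα1 : α < 1) :
    (0 < α →
      BallLip.lipSpace d μ p r l α = BallLip.holderSpace d μ p r l α ∧
      ∃ c : ℝ, 0 < c ∧ ∀ f ∈ BallLip.lipSpace d μ p r l α,
        BallLip.lipNorm d μ p r l α f ≤ ENNReal.ofReal c * BallLip.holderNorm d μ p r l α f ∧
        BallLip.holderNorm d μ p r l α f ≤ ENNReal.ofReal c * BallLip.lipNorm d μ p r l α f) ∧
    (α = 0 →
      BallLip.lipSpace d μ p r l α ⊆ BallLip.holderSpace d μ p r l α ∧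
      ∃ c : ℝ, 0 < c ∧ ∀ f ∈ BallLip.lipSpace d μ p r l α,
        BallLip.holderNorm d μ p r l α f ≤ ENNReal.ofReal c * BallLip.lipNorm d μ p r l α f) := by
  have hle := fun f (hf : BallLip.MemSpace p (Metric.closedBall 0 1) (BallLip.ballMeasure d μ) f) =>
    BallLip.holderNorm_le_lipNorm (l := l) hd hm hr hμ hp hα0 hf
  have hsub : BallLip.lipSpace d μ p r l α ⊆ BallLip.holderSpace d μ p r l α := fun f hf =>
    ⟨hf.1, (hle f hf.1).trans_lt hf.2⟩
  refine ⟨fun hα => ?_, fun _ => ⟨hsub, 1, one_pos, fun f hf => ?_⟩⟩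
  · obtain ⟨C, hC1, hC⟩ := BallLip.exists_lipNorm_le_holderNorm hd hm hr hl hμ hp hα hα1
    refine ⟨hsub.antisymm fun f hf => ⟨hf.1, (hC f hf.1 hf.2).trans_lt
      (ENNReal.mul_lt_top ENNReal.ofReal_lt_top hf.2)⟩, C, by linarith, fun f hf => ⟨?_, ?_⟩⟩
    · exact hC f hf.1 (hsub hf).2
    · exact (hle f hf.1).trans (le_mul_of_one_le_left' (ENNReal.one_le_ofReal.2 hC1))
  · rw [ENNReal.ofReal_one, one_mul]
    exact hle f hf.1
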